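/- Let $k$ be a field of characteristic zero, let $K=k(x_1,\dots,x_m)$ carry the partial derivations $\partial_i=\partial/\partial x_i$, and let $\mathcal U\supseteq K$ be a universal differential extension of $K$ in Kolchin's sense: $\mathcal U$ is a field with commuting derivations $\partial_1,\dots,\partial_m$ extending those of $K$, and for every finitely generated differential extension $F_1\subseteq\mathcal U$ of $K$, every finitely generated differential extension of $F_1$ embeds into $\mathcal U$ over $F_1$ as a differential field. Let $\mathcal M$ be the $\mathcal U$-vector space with basis $dx_1,\dots,dx_m$. Write $dg=\sum_i\partial_i(g)\,dx_i$ for $g\in\mathcal U$, and call $\omega=\sum_i f_i\,dx_i\in\mathcal M$ closed if $d\omega=\sum_i df_i\wedge dx_i=0$ in the exterior algebra of $\mathcal M$. For $t,b\in\mathcal U$, we say that $t$ is a logarithm of $b$ (and write $t=\log b$) if $b\neq0$ and $\partial_i t=\partial_i b/b$ for all $i$, and that $t$ is an exponential of $b$ if $t\ne 0$ and $\partial_i t/t=\partial_i b$ for all $i$. An elementary extension of a differential field $F$ with $K\subseteq F\subseteq\mathcal U$ is a differential field $E\subseteq\mathcal U$ of the form $E=F(t_1,\dots,t_r)$ in which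 each $t_j$ is algebraic over $F(t_1,\dots,t_{j-1})$, or a logarithm of an element of $F(t_1,\dots,t_{j-1})$, or an exponential of an element of $F(t_1,\dots,t_{j-1})$. **Theorem.** Let $F$ be a differential field with $K\subseteq F\subseteq\mathcal U$, and let $C=\{c\in F:\partial_1 c=\dots=\partial_m c=0\}$ be its field of constants, with algebraic closure $\overline C$ in $\mathcal U$. Let $\omega=f_1\,dx_1+\dots+f_m\,dx_m$ be a closed 1-form with $f_i\in F$ for all $i$. If there exist an elementary extension $E$ of $F$ and $g\in E$ such that $\omega=dg$, then there are $n\ge 0$, $a\in F$, $c_1,\dots,c_n\in\overline C$ and nonzero $b_1,\dots,b_n\in F(c_1,\dots,c_n)$ such that $$g=a+\sum_{j=1}^n c_j\log b_j ,$$ where for each $j$, $\log b_j$ denotes some logarithm of $b_j$ in $\mathcal U$. -/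

import Mathlib

universe u v

/-- A partial differential field: a field `A` with `m` commuting derivations
`der 0, …, der (m - 1)`. -/
class DiffField (m : ℕ) (A : Type u) [Field A] where
  /-- The derivations. -/
  der : Fin m → Derivation ℤ A A
  der_comm : ∀ i j a, der i (der j a) = der j (der i a)

namespace DiffField

/-! ### The field of rational functions with its partial derivatives -/

/-- The field `K = k(x₁, …, x_m)` of rational functions in `m` variables over `k`. -/
def RatFunField (m : ℕ) (k : Type v) [Field k] : Type v :=
  FractionRing (MvPolynomial (Fin m) k)

section RatFunField

variable (m : ℕ) (k : Type v) [Field k]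

noncomputable instance : Field (RatFunField m k) :=
  inferInstanceAs (Field (FractionRing (MvPolynomial (Fin m) k)))

noncomputable instance : Algebra (MvPolynomial (Fin m) k) (RatFunField m k) :=
  inferInstanceAs (Algebra (MvPolynomial (Fin m) k) (FractionRing (MvPolynomial (Fin m) k)))

instance : IsFractionRing (MvPolynomial (Fin m) k) (RatFunField m k) :=
  inferInstanceAs
    (IsFractionRing (MvPolynomial (Fin m) k) (FractionRing (MvPolynomial (Fin m) k)))

/-- The ring homomorphism `p ↦ p + (∂p/∂xᵢ) ε` from polynomials to the dual numbers `K[ε]`. -/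
noncomputable def polyToDual (i : Fin m) :
    MvPolynomial (Fin m) k →+* TrivSqZeroExt (RatFunField m k) (RatFunField m k) where
  toFun p := TrivSqZeroExt.inl (algebraMap _ (RatFunField m k) p) +
    TrivSqZeroExt.inr (algebraMap _ (RatFunField m k) (MvPolynomial.pderiv i p))
  map_one' := by ext <;> simp
  map_zero' := by ext <;> simp
  map_add' p q := by
    simp only [map_add, TrivSqZeroExt.inl_add, TrivSqZeroExt.inr_add]
    abel
  map_mul' p q := by
    ext
    · simp
    · simp only [Derivation.leibniz, smul_eq_mul, map_mul, map_add, TrivSqZeroExt.snd_add,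
        TrivSqZeroExt.snd_inl, TrivSqZeroExt.snd_inr, TrivSqZeroExt.snd_mul, TrivSqZeroExt.fst_add,
        TrivSqZeroExt.fst_inl, TrivSqZeroExt.fst_inr, MulOpposite.smul_eq_mul_unop,
        MulOpposite.unop_op]
      ring

theorem polyToDual_isUnit (i : Fin m) (y : nonZeroDivisors (MvPolynomial (Fin m) k)) :
    IsUnit (polyToDual m k i y) := by
  rw [TrivSqZeroExt.isUnit_iff_isUnit_fst]
  have : TrivSqZeroExt.fst (polyToDual m k i y) =
      algebraMap (MvPolynomial (Fin m) k) (RatFunField m k) y := by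
    simp [polyToDual]
  rw [this]
  exact IsLocalization.map_units _ y

/-- The extension of `polyToDual` to the field of rational functions. -/
noncomputable def ratToDual (i : Fin m) :
    RatFunField m k →+* TrivSqZeroExt (RatFunField m k) (RatFunField m k) :=
  IsLocalization.lift (M := nonZeroDivisors (MvPolynomial (Fin m) k)) (polyToDual_isUnit m k i)

theorem ratToDual_algebraMap (i : Fin m) (p : MvPolynomial (Fin m) k) :
    ratToDual m k i (algebraMap _ _ p) = polyToDual m k i p :=
  IsLocalization.lift_eq _ _

theorem fst_ratToDual (i : Fin m) (f : RatFunField m k) :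
    TrivSqZeroExt.fst (ratToDual m k i f) = f := by
  have : ((TrivSqZeroExt.fstHom (RatFunField m k) (RatFunField m k)
      (RatFunField m k)).toRingHom.comp (ratToDual m k i)) = RingHom.id _ := by
    apply IsLocalization.ringHom_ext (nonZeroDivisors (MvPolynomial (Fin m) k))
    refine RingHom.ext fun p => ?_
    simp [ratToDual_algebraMap, polyToDual]
  exact congrArg (fun φ : RatFunField m k →+* RatFunField m k => φ f) this

/-- The partial derivative `∂/∂xᵢ` on the field of rational functions. -/
noncomputable def partialDeriv (i : Fin m) :
    Derivation ℤ (RatFunField m k) (RatFunField m k) :=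
  Derivation.mk'
    ({ toFun := fun f => TrivSqZeroExt.snd (ratToDual m k i f)
       map_zero' := by simp
       map_add' := by simp } : RatFunField m k →+ RatFunField m k).toIntLinearMap
    (fun a b => by simp [fst_ratToDual, mul_comm])

/-- On polynomials `partialDeriv` is the usual partial derivative. -/
theorem partialDeriv_algebraMap (i : Fin m) (p : MvPolynomial (Fin m) k) :
    partialDeriv m k i (algebraMap _ _ p) = algebraMap _ _ (MvPolynomial.pderiv i p) := by
  change TrivSqZeroExt.snd (ratToDual m k i (algebraMap _ _ p)) = _
  rw [ratToDual_algebraMap]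
  exact (TrivSqZeroExt.snd_add _ _).trans (by
    rw [TrivSqZeroExt.snd_inl, TrivSqZeroExt.snd_inr, zero_add])

theorem partialDeriv_comm (i j : Fin m) (f : RatFunField m k) :
    partialDeriv m k i (partialDeriv m k j f) = partialDeriv m k j (partialDeriv m k i f) := by
  have key : ∀ p : MvPolynomial (Fin m) k,
      ⁅partialDeriv m k i, partialDeriv m k j⁆ (algebraMap _ (RatFunField m k) p) = 0 := by
    intro p
    rw [Derivation.commutator_apply]
    simp only [partialDeriv_algebraMap]
    have h0 : ⁅(MvPolynomial.pderiv i : Derivation k (MvPolynomial (Fin m) k)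
        (MvPolynomial (Fin m) k)),
        (MvPolynomial.pderiv j : Derivation k (MvPolynomial (Fin m) k) (MvPolynomial (Fin m) k))⁆
        = 0 := by
      apply MvPolynomial.derivation_ext
      intro l
      rw [Derivation.commutator_apply]
      simp only [MvPolynomial.pderiv_X, Pi.single_apply]
      split_ifs <;> simp
    rw [← map_sub, ← Derivation.commutator_apply, h0]
    simp
  have h : ⁅partialDeriv m k i, partialDeriv m k j⁆ f = 0 := by
    obtain ⟨p, q, -, rfl⟩ := IsFractionRing.div_surjective (A := MvPolynomial (Fin m) k) f
    rw [Derivation.leibniz_div, key, key]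
    simp
  rw [Derivation.commutator_apply] at h
  exact sub_eq_zero.mp h

/-- `k(x₁, …, x_m)` with `∂/∂x₁, …, ∂/∂x_m` is a partial differential field. -/
noncomputable instance ratFunDiffField : DiffField m (RatFunField m k) where
  der := partialDeriv m k
  der_comm := partialDeriv_comm m k

end RatFunField

/-! ### Differential extensions, differential subfields, constants -/

/-- The field extension `B` of `A` is a differential extension: the derivations of `B` extend
those of `A`. -/
class IsDiffExtension (m : ℕ) (A : Type v) (B : Type u) [Field A] [Field B] [DiffField m A]
    [DiffField m B] [Algebra A B] : Prop where
  der_algebraMap : ∀ (i : Fin m) (a : A),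
    (der i : Derivation ℤ B B) (algebraMap A B a) = algebraMap A B (der i a)

/-- The intermediate field `L` is closed under the derivations. If `B` is a differential extension
of `A`, these are the differential extensions of `A` inside `B`. -/
def IsDiffSubfield (m : ℕ) {A : Type v} {B : Type u} [Field A] [Field B] [Algebra A B]
    [DiffField m B] (L : IntermediateField A B) : Prop :=
  ∀ (i : Fin m), ∀ f ∈ L, (der i : Derivation ℤ B B) f ∈ L

/-- A differential subfield is itself a partial differential field. -/
@[reducible]
def IsDiffSubfield.diffField {m : ℕ} {A : Type v} {B : Type u} [Field A] [Field B] [Algebra A B]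
    [DiffField m B] {L : IntermediateField A B} (hL : IsDiffSubfield m L) : DiffField m L where
  der i := Derivation.mk'
    ({ toFun := fun f => ⟨(der i : Derivation ℤ B B) f, hL i f f.2⟩
       map_zero' := by ext; simp
       map_add' := fun a b => by ext; simp } : L →+ L).toIntLinearMap
    (fun a b => by ext; simp)
  der_comm i j a := Subtype.ext (der_comm i j (a : B))

/-- The intermediate field `L` is finitely generated as a differential extension of `A`: it is the
smallest differential subfield containing `A` and some finite set. -/
def IsDiffFG (m : ℕ) {A : Type v} {B : Type u} [Field A] [Field B] [Algebra A B]
    [DiffField m B] (L : IntermediateField A B) : Prop :=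
  ∃ S : Finset B, IsLeast {M : IntermediateField A B | IsDiffSubfield m M ∧ (S : Set B) ⊆ M} L

/-- The field of constants of a subfield `F` of `U`: the elements of `F` on which all the
derivations vanish. -/
def constants (m : ℕ) {U : Type u} [Field U] [DiffField m U] (F : Subfield U) : Subfield U where
  carrier := {f | f ∈ F ∧ ∀ i : Fin m, (der i : Derivation ℤ U U) f = 0}
  zero_mem' := ⟨F.zero_mem, by simp⟩
  one_mem' := ⟨F.one_mem, by simp⟩
  add_mem' := fun ha hb => ⟨F.add_mem ha.1 hb.1, fun i => by simp [ha.2 i, hb.2 i]⟩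
  mul_mem' := fun ha hb => ⟨F.mul_mem ha.1 hb.1, fun i => by simp [ha.2 i, hb.2 i]⟩
  neg_mem' := fun ha => ⟨F.neg_mem ha.1, fun i => by simp [ha.2 i]⟩
  inv_mem' := fun _ ha => ⟨F.inv_mem ha.1, fun i => by simp [Derivation.leibniz_inv, ha.2 i]⟩

/-! ### Universal differential extensions -/

/-- `U` is a universal differential extension of `K` (Kolchin): for every finitely generated
differential extension `F₁` of `K` inside `U`, every finitely generated differential extension `G`
of `F₁`, not necessarily inside `U`, has a differential embedding into `U` over `F₁`.

It suffices to let `G` range over the universe of `U`, since such a `G` is not larger than `U`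
up to isomorphism. -/
structure IsUniversalExtension (m : ℕ) (K : Type v) (U : Type u) [Field K] [Field U]
    [DiffField m K] [DiffField m U] [Algebra K U] : Prop where
  isDiffExtension : IsDiffExtension m K U
  exists_embedding : ∀ (F₁ : IntermediateField K U) (hF₁ : IsDiffSubfield m F₁), IsDiffFG m F₁ →
    ∀ (G : Type u) [Field G] [DiffField m G] [Algebra F₁ G],
      (letI := hF₁.diffField; IsDiffExtension m F₁ G) →
      IsDiffFG m (⊤ : IntermediateField F₁ G) →
      ∃ φ : G →ₐ[F₁] U, ∀ (i : Fin m) (z : G), φ (der i z) = der i (φ z)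

/-! ### Elementary extensions -/

section Elementary

variable (m : ℕ) {K : Type v} {U : Type u} [Field K] [Field U] [Algebra K U] [DiffField m U]

/-- `t` is a logarithm of `b`, that is, `b ≠ 0` and `∂ᵢ t = ∂ᵢ b / b` for all `i`. -/
def IsLogOf (t b : U) : Prop :=
  b ≠ 0 ∧ ∀ i : Fin m, (der i : Derivation ℤ U U) t = der i b / b

/-- `t` is an exponential of `b`, that is, `t ≠ 0` and `∂ᵢ t / t = ∂ᵢ b` for all `i`. -/
def IsExpOf (t b : U) : Prop :=
  t ≠ 0 ∧ ∀ i : Fin m, (der i : Derivation ℤ U U) t / t = der i b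

/-- `E` is an elementary extension of `F` inside `U`: it is a differential subfield of the form
`F(t₁, …, t_n)` where each `t_j` is algebraic, a logarithm or an exponential over
`F(t₁, …, t_{j-1})`. -/
def IsElementaryExtension (F E : IntermediateField K U) : Prop :=
  IsDiffSubfield m E ∧ ∃ (n : ℕ) (t : Fin n → U),
    E = F ⊔ IntermediateField.adjoin K (Set.range t) ∧
    ∀ j : Fin n, ∀ L : IntermediateField K U,
      L = F ⊔ IntermediateField.adjoin K (t '' {l | l < j}) →
        IsAlgebraic L (t j) ∨ (∃ b ∈ L, IsLogOf m (t j) b) ∨ (∃ b ∈ L, IsExpOf m (t j) b)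

end Elementary

/-! ### Differential forms -/

section Forms

variable (m : ℕ) {U : Type u} [Field U] [DiffField m U]

/-- The space of differential 1-forms: the `U`-vector space with basis `dx₁, …, dx_m`. The form
`∑ fᵢ dxᵢ` is the function `i ↦ fᵢ`. -/
abbrev OneForm (m : ℕ) (U : Type u) : Type u := Fin m → U

/-- The basis element `dxᵢ`. -/
def dx (i : Fin m) : OneForm m U := Pi.single i 1

/-- The differential `df = ∑ ∂ᵢ f dxᵢ` of a 0-form. -/
def d₀ (f : U) : OneForm m U := ∑ i : Fin m, (der i : Derivation ℤ U U) f • dx m i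

/-- The differential `dω = ∑ dfᵢ ∧ dxᵢ` of a 1-form `ω = ∑ fᵢ dxᵢ`, in the exterior algebra. -/
noncomputable def d₁ (ω : OneForm m U) : ExteriorAlgebra U (OneForm m U) :=
  ∑ i : Fin m, ExteriorAlgebra.ι U (d₀ m (ω i)) * ExteriorAlgebra.ι U (dx m i)

/-- A 1-form is closed if its differential vanishes. -/
def IsClosedForm (ω : OneForm m U) : Prop := d₁ m ω = 0

end Forms

end DiffField

/-!
# Liouville's theorem for several derivations, without assumptions on constants

Write `dlog b` for the tuple `∂ᵢ b / b`. The assertion amounts to an equation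
`dg = da + ∑ cⱼ dlog bⱼ` with `a ∈ F`, with `cⱼ` algebraic over the constants `C` of `F`, and with
`bⱼ ∈ F(c)`: a universal extension contains logarithms of all its nonzero elements
(`IsUniversalExtension.exists_isLogOf`), and two primitives of one form differ by a constant,
which is a logarithm of `1`.

An elementary extension of `F` may contain new constants, so the equation is first proved with all
constants `C_U` of `U` adjoined to `F`. No field above `F(C_U)` has new constants, and the equation
descends along an elementary tower one generator `t` at a time. For algebraic `t` one takes traces
and norms (`IsLogForm.of_isAlgebraic`). For a transcendental logarithm or exponential `t` over `L`
there is an `L`-derivation `D'` of `L(t)`, namely `d/dt` or `-t d/dt`, that commutes with the `∂ᵢ`.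
Applied to an identity `η = da + ∑ cⱼ dlog bⱼ` with `η` over `L`, it shows that
`D' a + ∑ cⱼ D' bⱼ / bⱼ` is a constant. Once a constant multiple of the
logarithm in question has been moved from `a` into the sum, this constant is zero, that is,
`Da + ∑ cⱼ D bⱼ / bⱼ = 0` with `D = d/dt`. If the `cⱼ` are replaced by a basis of the group they
generate, a comparison of poles at each prime of `L[t]` forces `a` and all `bⱼ`
into `L` (`mem_range_of_sum_logDeriv_eq_zero`, `IsLogForm.descend`).

It remains to pass from `F(C_U)` to `F`. Only finitely many constants `γ` occur. Since `F` and `C_U`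
are linearly disjoint over `C` (`scalarExtension_injective`), `F ⊗ C[γ]` embeds into `U`, and every
`C`-algebra homomorphism from `C[γ]` to an algebraic closure of `C` extends to a specialization of
`F ⊗ C[γ]` that commutes with the derivations. The Nullstellensatz provides one at which none of
the finitely many denominators and logarithmic arguments vanish (`exists_specialization`). `U` is
algebraically closed (`IsUniversalExtension.isAlgClosed`), so all this happens inside `U`. At last,
averaging over the conjugates of the finite extension of `F` so obtained brings `a` into `F`
(`exists_form_of_algebraic_constants`).
-/

open scoped Polynomial TensorProduct

namespace DiffField

/-! ### Extension of derivations, and consequences of universality -/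

section Extension

/-- A section `x ↦ x + (d x) ε` of the dual numbers `R[ε] → R` defines a derivation `d`. -/
theorem exists_derivation_of_ringHom {R : Type*} [Field R] (Φ : R →+* TrivSqZeroExt R R)
    (h : ∀ x, TrivSqZeroExt.fst (Φ x) = x) :
    ∃ d : Derivation ℤ R R, ∀ x, d x = TrivSqZeroExt.snd (Φ x) :=
  ⟨Derivation.mk'
    ({ toFun := fun f => TrivSqZeroExt.snd (Φ f)
       map_zero' := by simp
       map_add' := by simp } : R →+ R).toIntLinearMap
    (fun a b => by simp [h, mul_comm]), fun _ => rfl⟩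

/-- A derivation of `A` extends to the field `R = A(X)` with any prescribed value at `X`. -/
theorem exists_derivation_extension {A R : Type*} [Field A] [Field R] [Algebra A R]
    [Algebra A[X] R] [IsScalarTower A A[X] R] [IsFractionRing A[X] R]
    (d : Derivation ℤ A A) (v : R) :
    ∃ d' : Derivation ℤ R R,
      (∀ a, d' (algebraMap A R a) = algebraMap A R (d a)) ∧
        d' (algebraMap A[X] R Polynomial.X) = v := by
  let f : A →+* TrivSqZeroExt R R :=
    { toFun a := TrivSqZeroExt.inl (algebraMap A R a) +
        TrivSqZeroExt.inr (algebraMap A R (d a))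
      map_one' := by ext <;> simp
      map_zero' := by ext <;> simp
      map_add' a b := by ext <;> simp [Algebra.smul_def]
      map_mul' a b := by
        ext
        · simp
        · simp only [Derivation.leibniz, smul_eq_mul, map_mul, map_add, TrivSqZeroExt.snd_add,
            TrivSqZeroExt.snd_inl, TrivSqZeroExt.snd_inr, TrivSqZeroExt.snd_mul,
            TrivSqZeroExt.fst_add, TrivSqZeroExt.fst_inl, TrivSqZeroExt.fst_inr,
            MulOpposite.smul_eq_mul_unop, MulOpposite.unop_op]
          ring }
  let g : A[X] →+* TrivSqZeroExt R R := Polynomial.eval₂RingHom f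
    (TrivSqZeroExt.inl (algebraMap A[X] R Polynomial.X) + TrivSqZeroExt.inr v)
  have hC : ∀ a : A, algebraMap A[X] R (Polynomial.C a) = algebraMap A R a := fun a =>
    (IsScalarTower.algebraMap_apply A A[X] R a).symm
  have hg : ∀ p, TrivSqZeroExt.fst (g p) = algebraMap A[X] R p := by
    intro p
    have : ((TrivSqZeroExt.fstHom R R R).toRingHom.comp g) = algebraMap A[X] R := by
      ext <;> simp [g, f, hC]
    exact congrArg (fun φ : A[X] →+* R => φ p) this
  have hu : ∀ y : nonZeroDivisors A[X], IsUnit (g y) := by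
    intro y
    rw [TrivSqZeroExt.isUnit_iff_isUnit_fst, hg]
    exact IsLocalization.map_units _ y
  let Φ : R →+* TrivSqZeroExt R R := IsLocalization.lift (M := nonZeroDivisors A[X]) hu
  have hΦ : ∀ p, Φ (algebraMap A[X] R p) = g p := fun p => IsLocalization.lift_eq _ _
  have hfst : ∀ x, TrivSqZeroExt.fst (Φ x) = x := by
    intro x
    have : ((TrivSqZeroExt.fstHom R R R).toRingHom.comp Φ) = RingHom.id _ := by
      apply IsLocalization.ringHom_ext (nonZeroDivisors A[X])
      refine RingHom.ext fun p => ?_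
      simp [hΦ, hg]
    exact congrArg (fun φ : R →+* R => φ x) this
  obtain ⟨d', hd'⟩ := exists_derivation_of_ringHom Φ hfst
  refine ⟨d', fun a => ?_, ?_⟩
  · rw [hd', ← hC, hΦ]
    simp only [g, Polynomial.coe_eval₂RingHom, Polynomial.eval₂_C]
    exact (TrivSqZeroExt.snd_add _ _).trans (by
      rw [TrivSqZeroExt.snd_inl, TrivSqZeroExt.snd_inr, zero_add])
  · rw [hd', hΦ]
    simp [g]

/-- Two derivations of a field that agree on a set of generators are equal. -/
theorem derivation_eq_of_adjoin {A B : Type*} [Field A] [Field B] [Algebra A B] {S : Set B}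
    (hS : IntermediateField.adjoin A S = ⊤) (d e : Derivation ℤ B B)
    (hA : ∀ a, d (algebraMap A B a) = e (algebraMap A B a)) (h : ∀ s ∈ S, d s = e s) (x : B) :
    d x = e x := by
  have hx : x ∈ IntermediateField.adjoin A S := hS ▸ IntermediateField.mem_top
  induction hx using IntermediateField.adjoin_induction with
  | mem x hx => exact h x hx
  | algebraMap a => exact hA a
  | add x y _ _ hx hy => simp [hx, hy]
  | inv x _ hx => simp [Derivation.leibniz_inv, hx]
  | mul x y _ _ hx hy => simp [hx, hy]

theorem derivation_comm_of_adjoin {A B : Type*} [Field A] [Field B] [Algebra A B] {S : Set B}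
    (hS : IntermediateField.adjoin A S = ⊤) (d e : Derivation ℤ B B)
    (hA : ∀ a, d (e (algebraMap A B a)) = e (d (algebraMap A B a)))
    (h : ∀ s ∈ S, d (e s) = e (d s)) (x : B) : d (e x) = e (d x) := by
  have := derivation_eq_of_adjoin hS ⁅d, e⁆ 0
    (fun a => by simp [Derivation.commutator_apply, hA])
    (fun s hs => by simp [Derivation.commutator_apply, h s hs]) x
  simpa [Derivation.commutator_apply, sub_eq_zero] using this

/-- Embeddings of algebraic extensions commute with derivations. -/
theorem algHom_derivation {A R U : Type*} [Field A] [Field R] [Field U] [CharZero A] [Algebra A R]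
    [Algebra A U] [Algebra.IsAlgebraic A R] (dA : Derivation ℤ A A) (dR : Derivation ℤ R R)
    (dU : Derivation ℤ U U) (hR : ∀ a, dR (algebraMap A R a) = algebraMap A R (dA a))
    (hU : ∀ a, dU (algebraMap A U a) = algebraMap A U (dA a)) (σ : R →ₐ[A] U) (x : R) :
    σ (dR x) = dU (σ x) := by
  let : Differential A := ⟨dA⟩
  let : Differential R := ⟨dR⟩
  let : Differential U := ⟨dU⟩
  have : DifferentialAlgebra A R := ⟨hR⟩
  have : DifferentialAlgebra A U := ⟨hU⟩
  exact Differential.algHom_deriv' σ σ.injective x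

/-- A derivation extends to finite extensions in characteristic zero. -/
theorem exists_derivation_finite {A R : Type*} [Field A] [Field R] [CharZero A] [Algebra A R]
    [FiniteDimensional A R] (d : Derivation ℤ A A) :
    ∃ d' : Derivation ℤ R R, ∀ a, d' (algebraMap A R a) = algebraMap A R (d a) := by
  let : Differential A := ⟨d⟩
  let := Differential.differentialFiniteDimensional A R
  have : DifferentialAlgebra A R := Differential.differentialAlgebraFiniteDimensional
  exact ⟨Differential.deriv, fun a => DifferentialAlgebra.deriv_algebraMap a⟩

end Extension

section Universal

variable {m : ℕ} {K : Type v} {U : Type u} [Field K] [Field U] [Algebra K U]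

theorem exists_isDiffFG_of_finset [DiffField m U] (S : Finset U) :
    ∃ L : IntermediateField K U, IsDiffSubfield m L ∧ IsDiffFG m L ∧ (S : Set U) ⊆ L := by
  have h1 : IsDiffSubfield m (sInf {M : IntermediateField K U | IsDiffSubfield m M ∧
      (S : Set U) ⊆ M}) := by
    intro i f hf
    rw [← SetLike.mem_coe, IntermediateField.coe_sInf, Set.mem_iInter₂] at hf ⊢
    exact fun M hM => hM.1 i f (hf M hM)
  have h2 : (S : Set U) ⊆ (sInf {M : IntermediateField K U | IsDiffSubfield m M ∧
      (S : Set U) ⊆ M} : IntermediateField K U) := by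
    rw [IntermediateField.coe_sInf]
    exact Set.subset_iInter₂ fun M hM => hM.2
  exact ⟨_, h1, ⟨S, ⟨h1, h2⟩, fun M hM => sInf_le hM⟩, h2⟩

/-- Universality for extensions `G` of `L` that are finitely generated as fields, in terms of
derivations of `G` that commute on generators. -/
theorem IsUniversalExtension.exists_algHom [DiffField m K] [DiffField m U]
    (hU : IsUniversalExtension m K U) {L : IntermediateField K U} (hL : IsDiffSubfield m L)
    (hFG : IsDiffFG m L) (G : Type u) [Field G] [Algebra L G] (d : Fin m → Derivation ℤ G G)
    (hd : ∀ i (a : L), d i (algebraMap L G a) = algebraMap L G (hL.diffField.der i a))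
    (T : Finset G) (hT : IntermediateField.adjoin L (T : Set G) = ⊤)
    (hcomm : ∀ i j, ∀ s ∈ T, d i (d j s) = d j (d i s)) :
    ∃ φ : G →ₐ[L] U, ∀ i z, φ (d i z) = der i (φ z) := by
  let := hL.diffField
  let : DiffField m G := ⟨d, fun i j => derivation_comm_of_adjoin hT (d i) (d j)
    (fun a => by rw [hd, hd, hd, hd, der_comm]) (hcomm i j)⟩
  exact hU.exists_embedding L hL hFG G ⟨hd⟩ ⟨T, ⟨fun _ _ _ => IntermediateField.mem_top,
    fun _ _ => IntermediateField.mem_top⟩, fun M hM => hT ▸ IntermediateField.adjoin_le_iff.2 hM.2⟩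

/-- A root of `p` in a finite extension. The extension is an abstract field, so that its only
`ℤ`-algebra structure is the one coming from its ring structure. -/
theorem exists_finite_extension_root {A : Type u} [Field A] (p : A[X]) (hp : p.degree ≠ 0) :
    ∃ (R : Type u) (_ : Field R) (_ : Algebra A R), FiniteDimensional A R ∧
      ∃ x : R, Polynomial.aeval x p = 0 := by
  refine ⟨p.SplittingField, inferInstance, inferInstance, inferInstance, ?_⟩
  obtain ⟨x, hx⟩ := (Polynomial.SplittingField.splits p).exists_eval_eq_zero
    (by rwa [Polynomial.degree_map])
  exact ⟨x, by rwa [Polynomial.eval_map_algebraMap] at hx⟩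

/-- A universal differential extension is algebraically closed. -/
theorem IsUniversalExtension.isAlgClosed [CharZero K] [DiffField m K] [DiffField m U]
    (hU : IsUniversalExtension m K U) : IsAlgClosed U := by
  refine IsAlgClosed.of_exists_root U fun p hmon hirr => ?_
  obtain ⟨L, hL, hFG, hS⟩ := exists_isDiffFG_of_finset (m := m) (K := K) p.coeffs
  have hlift : p ∈ Polynomial.lifts (algebraMap L U) := by
    rw [Polynomial.lifts_iff_coeff_lifts]
    intro n
    by_cases h : p.coeff n = 0
    · exact ⟨0, by simp [h]⟩
    · exact ⟨⟨p.coeff n, hS (Polynomial.coeff_mem_coeffs h)⟩, rfl⟩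
  obtain ⟨q, rfl⟩ := (Polynomial.mem_lifts p).1 hlift
  have hq : q.degree ≠ 0 := by
    have := (Polynomial.degree_pos_of_irreducible hirr).ne'
    rwa [Polynomial.degree_map] at this
  obtain ⟨R, _, _, _, x, hx⟩ := exists_finite_extension_root q hq
  have : CharZero L := charZero_of_injective_algebraMap (algebraMap K L).injective
  choose d hd using fun i => exists_derivation_finite (R := R) (hL.diffField.der i)
  obtain ⟨T, hT⟩ : ∃ T : Finset R, IntermediateField.adjoin L (T : Set R) = ⊤ := by
    obtain ⟨a, ha⟩ := Field.exists_primitive_element L R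
    exact ⟨{a}, by simpa using ha⟩
  have hcomm : ∀ i j z, d i (d j z) = d j (d i z) := by
    intro i j z
    -- The commutator vanishes on `L`, so it is `L`-linear, and a separable algebraic extension
    -- has no nonzero derivations over its base field.
    have h0 := algHom_derivation (0 : Derivation ℤ L L) ⁅d i, d j⁆ (0 : Derivation ℤ R R)
      (fun a => by
        rw [Derivation.commutator_apply, hd, hd, hd, hd, hL.diffField.der_comm]
        simp) (by simp) (AlgHom.id L R) z
    simpa [Derivation.commutator_apply, sub_eq_zero] using h0
  obtain ⟨φ, -⟩ := hU.exists_algHom hL hFG R d hd T hT fun i j s _ => hcomm i j s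
  refine ⟨φ x, ?_⟩
  rw [Polynomial.eval_map_algebraMap, Polynomial.aeval_algHom_apply, hx, map_zero]

/-- The field of rational functions over `A`. It is an abstract field, so that its only `ℤ`-algebra
structure is the one coming from its ring structure. -/
theorem exists_isFractionRing_polynomial (A : Type u) [Field A] :
    ∃ (R : Type u) (_ : Field R) (_ : Algebra A R) (_ : Algebra A[X] R),
      IsScalarTower A A[X] R ∧ IsFractionRing A[X] R :=
  ⟨RatFunc A, inferInstance, inferInstance, inferInstance, inferInstance, inferInstance⟩

theorem adjoin_algebraMap_X_eq_top {A R : Type*} [Field A] [Field R] [Algebra A R]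
    [Algebra A[X] R] [IsScalarTower A A[X] R] [IsFractionRing A[X] R] :
    IntermediateField.adjoin A {algebraMap A[X] R Polynomial.X} = ⊤ := by
  refine eq_top_iff.2 fun x _ => ?_
  have key : ∀ p : A[X], algebraMap A[X] R p ∈
      IntermediateField.adjoin A {algebraMap A[X] R Polynomial.X} := by
    intro p
    have : algebraMap A[X] R p = Polynomial.aeval (algebraMap A[X] R Polynomial.X) p := by
      rw [Polynomial.aeval_algebraMap_apply, Polynomial.aeval_X_left_apply]
    rw [this]
    exact IntermediateField.algebra_adjoin_le_adjoin A _
      (Polynomial.aeval_mem_adjoin_singleton A _)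
  obtain ⟨p, q, -, rfl⟩ := IsFractionRing.div_surjective (A := A[X]) x
  exact div_mem (key p) (key q)

/-- Every nonzero element of a universal differential extension has a logarithm. -/
theorem IsUniversalExtension.exists_isLogOf [DiffField m K] [DiffField m U]
    (hU : IsUniversalExtension m K U) {b : U} (hb : b ≠ 0) : ∃ l, IsLogOf m l b := by
  obtain ⟨L, hL, hFG, hS⟩ := exists_isDiffFG_of_finset (m := m) (K := K) {b}
  have hbL : b ∈ L := hS (by simp)
  obtain ⟨R, _, _, _, _, _⟩ := exists_isFractionRing_polynomial L
  let := hL.diffField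
  let β : L := ⟨b, hbL⟩
  have hβ : β ≠ 0 := fun h => hb (congrArg Subtype.val h)
  choose d hd hdX using fun i : Fin m =>
    exists_derivation_extension (R := R) (hL.diffField.der i)
      (algebraMap L R (hL.diffField.der i β / β))
  obtain ⟨φ, hφ⟩ := hU.exists_algHom hL hFG R d hd {algebraMap L[X] R Polynomial.X}
    (by simpa using adjoin_algebraMap_X_eq_top) (fun i j s hs => by
      rw [Finset.mem_singleton.1 hs, hdX, hdX, hd, hd]
      congr 1
      rw [Derivation.leibniz_div, Derivation.leibniz_div, der_comm i j]
      simp only [smul_eq_mul]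
      ring)
  refine ⟨φ (algebraMap L[X] R Polynomial.X), hb, fun i => ?_⟩
  rw [← hφ, hdX, AlgHom.commutes]
  rfl

end Universal

/-! ### Identities between logarithmic derivatives in `L(X)` -/

section LogDerivative

variable {R : Type*} [Field R] (d : Derivation ℤ R R)

theorem derivation_mul_div {a b : R} (ha : a ≠ 0) (hb : b ≠ 0) :
    d (a * b) / (a * b) = d a / a + d b / b := by
  rw [Derivation.leibniz, smul_eq_mul, smul_eq_mul]
  field_simp
  ring

theorem derivation_zpow_div {a : R} (ha : a ≠ 0) (n : ℤ) :
    d (a ^ n) / a ^ n = n * (d a / a) := by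
  rw [Derivation.leibniz_zpow, zsmul_eq_mul, smul_eq_mul, zpow_sub_one₀ ha]
  field_simp

theorem derivation_prod_div {J : Type*} (s : Finset J) (b : J → R) (hb : ∀ j, b j ≠ 0) :
    d (∏ j ∈ s, b j) / ∏ j ∈ s, b j = ∑ j ∈ s, d (b j) / b j := by
  classical
  induction s using Finset.induction_on with
  | empty => simp
  | insert j s hj ih =>
    rw [Finset.prod_insert hj, Finset.sum_insert hj,
      derivation_mul_div d (hb j) (Finset.prod_ne_zero_iff.2 fun j _ => hb j), ih]

end LogDerivative

section Residues

variable {L R : Type*} [Field L] [Field R] [Algebra L[X] R] [IsFractionRing L[X] R]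

/-- The local ring at the prime `p` of the field `R = L(X)`: the fractions whose denominator is
not divisible by `p`. -/
def regularAt (R : Type*) [Field R] [Algebra L[X] R] [IsFractionRing L[X] R] {p : L[X]}
    (hp : Prime p) : Subring R where
  carrier := {x | ∃ r s : L[X], ¬ p ∣ s ∧ x = algebraMap L[X] R r / algebraMap L[X] R s}
  zero_mem' := ⟨0, 1, hp.not_dvd_one, by simp⟩
  one_mem' := ⟨1, 1, hp.not_dvd_one, by simp⟩
  neg_mem' := by
    rintro _ ⟨r, s, hs, rfl⟩
    exact ⟨-r, s, hs, by simp [neg_div]⟩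
  mul_mem' := by
    rintro _ _ ⟨r, s, hs, rfl⟩ ⟨r', s', hs', rfl⟩
    exact ⟨r * r', s * s', hp.not_dvd_mul hs hs', by simp [div_mul_div_comm]⟩
  add_mem' := by
    rintro _ _ ⟨r, s, hs, rfl⟩ ⟨r', s', hs', rfl⟩
    have h0 : ∀ q : L[X], ¬ p ∣ q → algebraMap L[X] R q ≠ 0 := fun q hq => by
      rw [Ne, FaithfulSMul.algebraMap_eq_zero_iff]
      rintro rfl
      exact hq (dvd_zero p)
    exact ⟨r * s' + s * r', s * s', hp.not_dvd_mul hs hs', by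
      simp [div_add_div _ _ (h0 s hs) (h0 s' hs')]⟩

variable {p : L[X]} (hp : Prime p)

theorem algebraMap_ne_zero_of_not_dvd {q : L[X]} (hq : ¬ p ∣ q) : algebraMap L[X] R q ≠ 0 := by
  rw [Ne, FaithfulSMul.algebraMap_eq_zero_iff]
  rintro rfl
  exact hq (dvd_zero p)

theorem algebraMap_mem_regularAt (q : L[X]) : algebraMap L[X] R q ∈ regularAt R hp :=
  ⟨q, 1, hp.not_dvd_one, by simp⟩

theorem algebraMap_inv_mem_regularAt {q : L[X]} (hq : ¬ p ∣ q) :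
    (algebraMap L[X] R q)⁻¹ ∈ regularAt R hp :=
  ⟨1, q, hq, by simp⟩

theorem div_prime_notMem_regularAt {u : R} (hu : u⁻¹ ∈ regularAt R hp) (h0 : u ≠ 0) :
    u / algebraMap L[X] R p ∉ regularAt R hp := by
  intro h
  have h1 : (algebraMap L[X] R p)⁻¹ ∈ regularAt R hp := by
    have := mul_mem hu h
    rwa [div_eq_mul_inv, ← mul_assoc, inv_mul_cancel₀ h0, one_mul] at this
  obtain ⟨r, s, hs, h2⟩ := h1
  have hs0 : algebraMap L[X] R s ≠ 0 := algebraMap_ne_zero_of_not_dvd hs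
  have hp0 : algebraMap L[X] R p ≠ 0 := by
    rw [Ne, FaithfulSMul.algebraMap_eq_zero_iff]
    exact hp.ne_zero
  apply hs
  refine ⟨r, ?_⟩
  apply IsFractionRing.injective L[X] R
  rw [map_mul]
  field_simp at h2
  linear_combination h2

/-- The factorization `x = pⁿ u` with `u` a unit of the local ring at `p`. -/
theorem exists_eq_zpow_mul (x : R) (hx : x ≠ 0) :
    ∃ (n : ℤ) (u : R), u ≠ 0 ∧ u ∈ regularAt R hp ∧ u⁻¹ ∈ regularAt R hp ∧
      x = algebraMap L[X] R p ^ n * u := by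
  obtain ⟨r, s, hs, rfl⟩ := IsFractionRing.div_surjective (A := L[X]) x
  have hs0 : s ≠ 0 := nonZeroDivisors.ne_zero hs
  have hr0 : r ≠ 0 := by
    rintro rfl
    simp at hx
  have hp0 : algebraMap L[X] R p ≠ 0 := by
    rw [Ne, FaithfulSMul.algebraMap_eq_zero_iff]
    exact hp.ne_zero
  obtain ⟨n, r', hr', rfl⟩ := WfDvdMonoid.max_power_factor' hr0 hp.not_isUnit
  obtain ⟨k, s', hs', rfl⟩ := WfDvdMonoid.max_power_factor' hs0 hp.not_isUnit
  have h1 := algebraMap_ne_zero_of_not_dvd (R := R) hr'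
  have h2 := algebraMap_ne_zero_of_not_dvd (R := R) hs'
  refine ⟨n - k, algebraMap L[X] R r' / algebraMap L[X] R s', div_ne_zero h1 h2,
    ⟨_, _, hs', rfl⟩, ⟨s', r', hr', by rw [inv_div]⟩, ?_⟩
  rw [zpow_sub₀ hp0, zpow_natCast, zpow_natCast]
  simp only [map_mul, map_pow]
  field_simp

theorem derivation_mem_regularAt {D : Derivation ℤ R R}
    (hD : ∀ q, D (algebraMap L[X] R q) = algebraMap L[X] R (Polynomial.derivative q))
    {x : R} (hx : x ∈ regularAt R hp) : D x ∈ regularAt R hp := by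
  obtain ⟨r, s, hs, rfl⟩ := hx
  refine ⟨s * Polynomial.derivative r - r * Polynomial.derivative s, s * s,
    hp.not_dvd_mul hs hs, ?_⟩
  have h2 := algebraMap_ne_zero_of_not_dvd (R := R) hs
  rw [Derivation.leibniz_div, hD, hD]
  simp only [map_sub, map_mul, smul_eq_mul]
  field_simp

theorem not_dvd_derivative [CharZero L] (hp : Prime p) : ¬ p ∣ Polynomial.derivative p := fun h =>
  hp.not_isUnit (hp.irreducible.separable.isUnit_of_dvd' dvd_rfl h)

theorem mem_range_of_regularAt {x : R} (h : ∀ (p : L[X]) (hp : Prime p), x ∈ regularAt R hp) :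
    ∃ q : L[X], algebraMap L[X] R q = x := by
  obtain ⟨r, s, hrs, hx⟩ := IsFractionRing.exists_reduced_fraction (A := L[X]) x
  have hs0 : (s : L[X]) ≠ 0 := nonZeroDivisors.ne_zero s.2
  have hx' : x = algebraMap L[X] R r / algebraMap L[X] R s := by
    rw [← hx, IsFractionRing.mk'_eq_div]
  have hunit : IsUnit (s : L[X]) := by
    by_contra hns
    obtain ⟨p, hirr, hps⟩ := WfDvdMonoid.exists_irreducible_factor hns hs0
    have hp := hirr.prime
    obtain ⟨r', s', hs', hx''⟩ := h p hp
    have h1 := algebraMap_ne_zero_of_not_dvd (R := R) hs'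
    have h2 : algebraMap L[X] R s ≠ 0 := by
      rwa [Ne, FaithfulSMul.algebraMap_eq_zero_iff]
    have h3 : r * s' = r' * s := by
      apply IsFractionRing.injective L[X] R
      rw [hx', div_eq_div_iff h2 h1] at hx''
      simpa using hx''
    have h4 : p ∣ r := by
      refine (hp.dvd_or_dvd (h3 ▸ Dvd.dvd.mul_left hps r' : p ∣ r * s')).resolve_right hs'
    exact hp.not_isUnit (hrs h4 hps)
  obtain ⟨v, hv⟩ := hunit.exists_right_inv
  refine ⟨r * v, ?_⟩
  have h2 : algebraMap L[X] R s ≠ 0 := by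
    rwa [Ne, FaithfulSMul.algebraMap_eq_zero_iff]
  rw [hx', eq_div_iff h2, ← map_mul]
  congr 1
  linear_combination r * hv

variable [Algebra L R] [IsScalarTower L L[X] R]

/-- Comparison of the polar parts at `p` in an identity `D a + ∑ eⱼ D bⱼ / bⱼ = 0`: a pole of `a`
would give a pole of order at least two of `D a`, while logarithmic derivatives have simple poles.
Hence `a` is regular, and the residue `∑ nⱼ eⱼ` of the second term vanishes. -/
theorem regularAt_and_residue_eq_zero [CharZero L] {D : Derivation ℤ R R}
    (hD : ∀ q, D (algebraMap L[X] R q) = algebraMap L[X] R (Polynomial.derivative q))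
    {J : Type*} [Fintype J] (e : J → L) (b : J → R) (a : R)
    (h : D a + ∑ j, algebraMap L R (e j) * (D (b j) / b j) = 0) (n : J → ℤ) (u : J → R)
    (hu0 : ∀ j, u j ≠ 0) (hu : ∀ j, u j ∈ regularAt R hp) (hu' : ∀ j, (u j)⁻¹ ∈ regularAt R hp)
    (hbu : ∀ j, b j = algebraMap L[X] R p ^ n j * u j) :
    a ∈ regularAt R hp ∧ ∑ j, n j • e j = 0 := by
  set P := algebraMap L[X] R p with hP
  set P' := algebraMap L[X] R (Polynomial.derivative p) with hP'
  have hp0 : P ≠ 0 := by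
    rw [hP, Ne, FaithfulSMul.algebraMap_eq_zero_iff]
    exact hp.ne_zero
  have hC : ∀ c : L, algebraMap L R c = algebraMap L[X] R (Polynomial.C c) := fun c =>
    IsScalarTower.algebraMap_apply L L[X] R c
  have hCmem : ∀ c : L, algebraMap L R c ∈ regularAt R hp := fun c =>
    hC c ▸ algebraMap_mem_regularAt hp _
  have hPmem : P ∈ regularAt R hp := algebraMap_mem_regularAt hp p
  -- A nonzero constant times `p' / p` times a unit is not regular.
  have hpole : ∀ (c : L) (w : R), c ≠ 0 → w ≠ 0 → w⁻¹ ∈ regularAt R hp →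
      algebraMap L R c * P' * w / P ∉ regularAt R hp := by
    intro c w hc hw hw'
    have hq : ¬ p ∣ Polynomial.C c * Polynomial.derivative p := by
      refine hp.not_dvd_mul (fun hd => hp.not_isUnit ?_) (not_dvd_derivative hp)
      exact isUnit_of_dvd_unit hd (Polynomial.isUnit_C.2 hc.isUnit)
    have e1 : algebraMap L R c * P' * w =
        algebraMap L[X] R (Polynomial.C c * Polynomial.derivative p) * w := by
      rw [map_mul, hC]
    rw [e1]
    refine div_prime_notMem_regularAt hp ?_
      (mul_ne_zero (algebraMap_ne_zero_of_not_dvd hq) hw)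
    rw [mul_inv]
    exact mul_mem (algebraMap_inv_mem_regularAt hp hq) hw'
  have hS : ∃ ρ ∈ regularAt R hp, ∑ j, algebraMap L R (e j) * (D (b j) / b j) =
      algebraMap L R (∑ j, n j • e j) * (P' / P) + ρ := by
    refine ⟨∑ j, algebraMap L R (e j) * (D (u j) * (u j)⁻¹), sum_mem fun j _ =>
      mul_mem (hCmem _) (mul_mem (derivation_mem_regularAt hp hD (hu j)) (hu' j)), ?_⟩
    rw [map_sum, Finset.sum_mul, ← Finset.sum_add_distrib]
    refine Finset.sum_congr rfl fun j _ => ?_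
    rw [hbu j, derivation_mul_div D (zpow_ne_zero _ hp0) (hu0 j), derivation_zpow_div D hp0, hD,
      zsmul_eq_mul, map_mul, map_intCast]
    ring
  obtain ⟨ρ, hρ, hS⟩ := hS
  have hDa : D a = -(algebraMap L R (∑ j, n j • e j) * (P' / P) + ρ) := by
    rw [← hS]
    exact eq_neg_of_add_eq_zero_left h
  have ha : a ∈ regularAt R hp := by
    by_cases ha0 : a = 0
    · exact ha0 ▸ zero_mem _
    obtain ⟨N, w, hw0, hw, hw', haw⟩ := exists_eq_zpow_mul (R := R) hp a ha0
    rcases lt_or_ge N 0 with hN | hN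
    · exfalso
      obtain ⟨k, hk⟩ : ∃ k : ℕ, N = -((k : ℤ) + 1) := ⟨(-N - 1).toNat, by omega⟩
      have hwa : w = P ^ (k + 1) * a := by
        rw [haw, hk, zpow_neg, ← mul_assoc, ← zpow_natCast]
        push_cast
        rw [mul_inv_cancel₀ (zpow_ne_zero _ hp0), one_mul]
      have h1 : P ^ (k + 1) * D a ∈ regularAt R hp := by
        have : P ^ (k + 1) * D a =
            P ^ k * -(algebraMap L R (∑ j, n j • e j) * P' + P * ρ) := by
          rw [hDa]
          field_simp
          ring
        rw [this]
        exact mul_mem (pow_mem hPmem _) (neg_mem (add_mem (mul_mem (hCmem _)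
          (algebraMap_mem_regularAt hp _)) (mul_mem hPmem hρ)))
      have h2 : algebraMap L R ((k : L) + 1) * P' * w / P = D w - P ^ (k + 1) * D a := by
        conv_rhs => rw [hwa]
        rw [Derivation.leibniz, Derivation.leibniz_pow, hD, hwa, map_add, map_natCast, map_one]
        simp only [smul_eq_mul, nsmul_eq_mul, Nat.cast_add, Nat.cast_one, Nat.add_sub_cancel]
        field_simp
        ring
      exact hpole _ w (Nat.cast_add_one_ne_zero k) hw0 hw'
        (h2 ▸ sub_mem (derivation_mem_regularAt hp hD hw) h1)
    · lift N to ℕ using hN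
      rw [haw, zpow_natCast]
      exact mul_mem (pow_mem hPmem _) hw
  refine ⟨ha, ?_⟩
  by_contra hne
  refine hpole _ 1 hne one_ne_zero (by simp) ?_
  have : algebraMap L R (∑ j, n j • e j) * P' * 1 / P = -D a - ρ := by
    rw [hDa]
    ring
  rw [this]
  exact sub_mem (neg_mem (derivation_mem_regularAt hp hD ha)) hρ

/-- An identity `D a + ∑ eⱼ D bⱼ / bⱼ = 0` in `L(X)`, where `D = d/dX` and the coefficients
`eⱼ ∈ L` are linearly independent over `ℤ`, holds only trivially. -/
theorem mem_range_of_sum_logDeriv_eq_zero [CharZero L] {D : Derivation ℤ R R}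
    (hDC : ∀ c, D (algebraMap L R c) = 0) (hDX : D (algebraMap L[X] R Polynomial.X) = 1)
    {J : Type*} [Fintype J] (e : J → L) (he : LinearIndependent ℤ e) (b : J → R)
    (hb : ∀ j, b j ≠ 0) (a : R)
    (h : D a + ∑ j, algebraMap L R (e j) * (D (b j) / b j) = 0) :
    (∃ a', algebraMap L R a' = a) ∧ ∀ j, ∃ b', algebraMap L R b' = b j := by
  have hC : ∀ c : L, algebraMap L[X] R (Polynomial.C c) = algebraMap L R c := fun c =>
    (IsScalarTower.algebraMap_apply L L[X] R c).symm
  have hD : ∀ q, D (algebraMap L[X] R q) = algebraMap L[X] R (Polynomial.derivative q) := by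
    intro q
    induction q using Polynomial.induction_on' with
    | add q r hq hr => simp [hq, hr]
    | monomial n c =>
      rw [← Polynomial.C_mul_X_pow_eq_monomial, map_mul, map_pow, Derivation.leibniz, hC, hDC,
        Derivation.leibniz_pow, hDX, Polynomial.derivative_C_mul_X_pow]
      simp [hC, mul_assoc]
  have key : ∀ (p : L[X]) (hp : Prime p), a ∈ regularAt R hp ∧ ∀ j, b j ∈ regularAt R hp ∧
      (b j)⁻¹ ∈ regularAt R hp := by
    intro p hp
    choose n u hu0 hu hu' hbu using fun j => exists_eq_zpow_mul (R := R) hp (b j) (hb j)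
    obtain ⟨h1, h2⟩ := regularAt_and_residue_eq_zero hp hD e b a h n u hu0 hu hu' hbu
    have hn : ∀ j, n j = 0 := Fintype.linearIndependent_iff.1 he n h2
    refine ⟨h1, fun j => ?_⟩
    rw [hbu j, hn j, zpow_zero, one_mul]
    exact ⟨hu j, hu' j⟩
  have hb' : ∀ j, ∃ b', algebraMap L R b' = b j := by
    intro j
    obtain ⟨q, hq⟩ := mem_range_of_regularAt (x := b j) fun p hp => ((key p hp).2 j).1
    obtain ⟨r, hr⟩ := mem_range_of_regularAt (x := (b j)⁻¹) fun p hp => ((key p hp).2 j).2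
    have hqr : q * r = 1 := by
      apply IsFractionRing.injective L[X] R
      rw [map_mul, hq, hr, mul_inv_cancel₀ (hb j), map_one]
    obtain ⟨c, -, rfl⟩ := Polynomial.isUnit_iff.1 (IsUnit.of_mul_eq_one r hqr)
    exact ⟨c, by rw [← hC, hq]⟩
  refine ⟨?_, hb'⟩
  have hDa : D a = 0 := by
    rw [Finset.sum_eq_zero, add_zero] at h
    · exact h
    · intro j _
      obtain ⟨b', hb'⟩ := hb' j
      rw [← hb', hDC]
      simp
  obtain ⟨q, rfl⟩ := mem_range_of_regularAt (x := a) fun p hp => (key p hp).1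
  rw [hD, FaithfulSMul.algebraMap_eq_zero_iff] at hDa
  rw [Polynomial.eq_C_of_derivative_eq_zero hDa]
  exact ⟨_, (hC _).symm⟩

end Residues

/-! ### Logarithmic forms over transcendental extensions -/

section LogForm

/-- The tuple `η`, thought of as the form `∑ ηᵢ dxᵢ`, is equal to `da + ∑ⱼ cⱼ dbⱼ / bⱼ` for some
`a, bⱼ ∈ S` and constants `cⱼ`, which need not lie in `S`. -/
def IsLogForm {ι B : Type*} [Field B] (δ : ι → Derivation ℤ B B) (S : Set B) (η : ι → B) :
    Prop :=
  ∃ (J : Type) (_ : Fintype J) (c b : J → B), ∃ a ∈ S,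
    (∀ j i, δ i (c j) = 0) ∧ (∀ j, b j ∈ S ∧ b j ≠ 0) ∧
      ∀ i, η i = δ i a + ∑ j, c j * (δ i (b j) / b j)

/-- Finitely many elements of a field of characteristic zero are integral combinations of
elements that are linearly independent over `ℤ`. -/
theorem exists_linearIndependent_int {A J : Type*} [Field A] [CharZero A] [Fintype J] (c : J → A) :
    ∃ (k : ℕ) (e : Fin k → A) (n : J → Fin k → ℤ), LinearIndependent ℤ e ∧
      (∀ i, e i ∈ Submodule.span ℤ (Set.range c)) ∧ ∀ j, c j = ∑ i, n j i • e i := by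
  let N := Submodule.span ℤ (Set.range c)
  have : Module.Finite ℤ N := Module.Finite.span_of_finite ℤ (Set.finite_range c)
  have : Module.IsTorsionFree ℤ N := inferInstance
  have : Module.Free ℤ N := Module.free_of_finite_type_torsion_free'
  let B := Module.finBasis ℤ N
  refine ⟨_, fun i => (B i : A), fun j i => B.repr ⟨c j, Submodule.subset_span ⟨j, rfl⟩⟩ i,
    ?_, fun i => (B i).2, fun j => ?_⟩
  · exact B.linearIndependent.map' N.subtype (Submodule.ker_subtype N)
  · have := congrArg N.subtype (B.sum_repr ⟨c j, Submodule.subset_span ⟨j, rfl⟩⟩)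
    rw [map_sum] at this
    exact this.symm

/-- Multiplicativity of logarithmic derivatives. -/
theorem sum_mul_logDeriv_eq {R J I : Type*} [Field R] [Fintype J] [Fintype I]
    (d : Derivation ℤ R R) (c b : J → R) (hb : ∀ j, b j ≠ 0) (e : I → R) (n : J → I → ℤ)
    (h : ∀ j, c j = ∑ i, n j i • e i) :
    ∑ j, c j * (d (b j) / b j) =
      ∑ i, e i * (d (∏ j, b j ^ n j i) / ∏ j, b j ^ n j i) := by
  simp_rw [derivation_prod_div d Finset.univ _ fun j => zpow_ne_zero _ (hb j)]
  simp_rw [derivation_zpow_div d (hb _), h, Finset.sum_mul, Finset.mul_sum]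
  rw [Finset.sum_comm]
  refine Finset.sum_congr rfl fun i _ => Finset.sum_congr rfl fun j _ => ?_
  rw [zsmul_eq_mul]
  ring

variable {L M ι : Type*} [Field L] [Field M] [CharZero L] [Algebra L M]

theorem derivation_commutes_logDeriv (d D : Derivation ℤ M M) (w : M)
    (h : ∀ x, d (w * D x) = w * D (d x)) (b : M) :
    d (w * (D b / b)) = w * D (d b / b) := by
  have e1 : w * (D b / b) = (w * D b) / b := by ring
  rw [e1, Derivation.leibniz_div, Derivation.leibniz_div, h]
  simp only [smul_eq_mul]
  ring

/-- Descent of logarithmic forms from `R = L(X)` to `L`, where `D = d/dX`. The vector field `w D` commutes with the derivations `δ i`,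
and `v` is a logarithm of `u`, normalized so that `w D v - w D u / u = 1`. -/
theorem IsLogForm.descend {R : Type*} [Field R] [Algebra L R] [Algebra L[X] R]
    [IsScalarTower L L[X] R] [IsFractionRing L[X] R] (δ : ι → Derivation ℤ R R)
    (hconst : ∀ x, (∀ i, δ i x = 0) → x ∈ Set.range (algebraMap L R))
    {D : Derivation ℤ R R} (hDC : ∀ c, D (algebraMap L R c) = 0)
    (hDX : D (algebraMap L[X] R Polynomial.X) = 1) (w v u : R) (hu : u ≠ 0)
    (hcomm : ∀ i x, δ i (w * D x) = w * D (δ i x)) (hvu : ∀ i, δ i v = δ i u / u)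
    (hw : w * (D v - D u / u) = 1) {η : ι → R} (hη : ∀ i, η i ∈ Set.range (algebraMap L R))
    (h : IsLogForm δ Set.univ η) :
    IsLogForm δ (Set.range (algebraMap L R)) η := by
  obtain ⟨J, _, c, b, a, -, hc, hb, hf⟩ := h
  have hw0 : w ≠ 0 := left_ne_zero_of_mul_eq_one hw
  have hcL : ∀ j, c j ∈ Set.range (algebraMap L R) := fun j => hconst _ (hc j)
  choose c' hc' using hcL
  have hDc : ∀ j, D (c j) = 0 := fun j => hc' j ▸ hDC _
  -- Applying `w D` to the identity for `η` shows that this element is a constant.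
  set κ := w * D a + ∑ j, c j * (w * (D (b j) / b j)) with hκdef
  have hκ : ∀ i, δ i κ = 0 := by
    intro i
    have h1 : δ i κ = w * D (η i) := by
      rw [hf i, hκdef, map_add, hcomm, map_sum, map_add, mul_add, map_sum, Finset.mul_sum]
      congr 1
      refine Finset.sum_congr rfl fun j _ => ?_
      rw [Derivation.leibniz, hc j i, derivation_commutes_logDeriv _ _ _ (hcomm i),
        Derivation.leibniz, hDc]
      simp only [smul_eq_mul]
      ring
    obtain ⟨y, hy⟩ := hη i
    rw [h1, ← hy, hDC, mul_zero]
  obtain ⟨κ', hκ'⟩ := hconst κ hκ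
  -- The term `κ v` is moved out of `a`: as `δ v = δ u / u`, it becomes `κ δ u / u`, and the
  -- normalization of `w` makes the constant `κ` disappear from the identity for `D`.
  let c₁ : Option J → L := fun o => o.elim κ' c'
  let b₁ : Option J → R := fun o => o.elim u b
  have hb₁ : ∀ o, b₁ o ≠ 0 := by
    rintro (_ | j)
    exacts [hu, (hb j).2]
  have hc₁ : ∀ o i, δ i (algebraMap L R (c₁ o)) = 0 := by
    rintro (_ | j) i
    · exact hκ' ▸ hκ i
    · exact (congrArg (δ i) (hc' j)).trans (hc j i)
  have hf₁ : ∀ i, η i = δ i (a - κ * v) + ∑ o, algebraMap L R (c₁ o) * (δ i (b₁ o) / b₁ o) := by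
    intro i
    rw [Fintype.sum_option, map_sub, Derivation.leibniz, hκ, hf i]
    simp only [c₁, b₁, Option.elim, hκ', hc', hvu, smul_eq_mul]
    ring
  have hD₁ : D (a - κ * v) + ∑ o, algebraMap L R (c₁ o) * (D (b₁ o) / b₁ o) = 0 := by
    have hDκ : D κ = 0 := hκ' ▸ hDC _
    rw [Fintype.sum_option, map_sub, Derivation.leibniz, hDκ]
    simp only [c₁, b₁, Option.elim, hκ', hc', smul_eq_mul, mul_zero, add_zero]
    have h2 : w * (D a + ∑ j, c j * (D (b j) / b j)) = κ := by
      rw [hκdef, mul_add, Finset.mul_sum]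
      congr 1
      exact Finset.sum_congr rfl fun j _ => by ring
    apply mul_left_cancel₀ hw0
    linear_combination h2 - κ * hw
  obtain ⟨k, e, n, he, hspan, hce⟩ := exists_linearIndependent_int c₁
  have hce' : ∀ o, algebraMap L R (c₁ o) = ∑ i, n o i • algebraMap L R (e i) := fun o => by
    rw [hce o, map_sum]
    simp_rw [map_zsmul]
  have hβ : ∀ i, ∏ o, b₁ o ^ n o i ≠ 0 := fun i =>
    Finset.prod_ne_zero_iff.2 fun o _ => zpow_ne_zero _ (hb₁ o)
  rw [sum_mul_logDeriv_eq D _ b₁ hb₁ _ n hce'] at hD₁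
  obtain ⟨ha', hβ'⟩ := mem_range_of_sum_logDeriv_eq_zero hDC hDX e he _ hβ _ hD₁
  have he0 : ∀ i k, δ i (algebraMap L R (e k)) = 0 := by
    intro i k
    have hk := hspan k
    generalize e k = x at hk
    induction hk using Submodule.span_induction with
    | mem x hx =>
      obtain ⟨o, rfl⟩ := hx
      exact hc₁ o i
    | zero => simp
    | add x y _ _ hx hy => simp [hx, hy]
    | smul z x _ hx => rw [map_zsmul, map_zsmul, hx, smul_zero]
  refine ⟨Fin k, inferInstance, fun i => algebraMap L R (e i), fun i => ∏ o, b₁ o ^ n o i,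
    a - κ * v, ha', fun j i => he0 i j, fun j => ⟨hβ' j, hβ j⟩, fun i => ?_⟩
  rw [hf₁ i, sum_mul_logDeriv_eq (δ i) _ b₁ hb₁ _ n hce']

/-- Descent of logarithmic forms from `L(t)` to `L` for `t` a logarithm or an exponential. The
vector field `w D` is `d/dt` in the first case and `-t d/dt` in the second. -/
theorem IsLogForm.descend_log_or_exp {R : Type*} [Field R] [Algebra L R] [Algebra L[X] R]
    [IsScalarTower L L[X] R] [IsFractionRing L[X] R] (δ : ι → Derivation ℤ R R)
    (hδ : ∀ i c, ∃ c', δ i (algebraMap L R c) = algebraMap L R c')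
    (hconst : ∀ x, (∀ i, δ i x = 0) → x ∈ Set.range (algebraMap L R)) {t : R}
    (ht : algebraMap L[X] R Polynomial.X = t)
    (hcase : (∃ b, b ≠ 0 ∧ ∀ i, δ i t = δ i (algebraMap L R b) / algebraMap L R b) ∨
      ∃ b, ∀ i, δ i t = t * δ i (algebraMap L R b))
    {η : ι → R} (hη : ∀ i, η i ∈ Set.range (algebraMap L R))
    (h : IsLogForm δ Set.univ η) :
    IsLogForm δ (Set.range (algebraMap L R)) η := by
  have ht0 : t ≠ 0 := by
    rw [← ht, Ne, FaithfulSMul.algebraMap_eq_zero_iff]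
    exact Polynomial.X_ne_zero
  obtain ⟨D, hDC, hDX⟩ := exists_derivation_extension (R := R) (0 : Derivation ℤ L L) 1
  replace hDC : ∀ c, D (algebraMap L R c) = 0 := fun c => by simp [hDC]
  have hDt : D t = 1 := ht ▸ hDX
  have htop : IntermediateField.adjoin L {t} = ⊤ := by
    rw [← ht]
    exact adjoin_algebraMap_X_eq_top
  choose δL hδL using hδ
  rcases hcase with ⟨b, hb0, htb⟩ | ⟨b, htb⟩
  · have hδt : ∀ i, δ i t = algebraMap L R (δL i b / b) := fun i => by
      rw [htb, hδL, map_div₀]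
    have hb0' : algebraMap L R b ≠ 0 := by simpa using hb0
    refine IsLogForm.descend δ hconst hDC hDX 1 t (algebraMap L R b) hb0' (fun i x => ?_) htb ?_
      hη h
    · rw [one_mul, one_mul]
      refine derivation_comm_of_adjoin htop (δ i) D (fun a => ?_) (fun s hs => ?_) x
      · rw [hδL, hDC, hDC, map_zero]
      · rw [Set.mem_singleton_iff.1 hs, hδt, hDC, hDt, Derivation.map_one_eq_zero]
    · rw [hDC, hDt, zero_div, sub_zero, one_mul]
  · refine IsLogForm.descend δ hconst hDC hDX (-t) (algebraMap L R b) t ht0 (fun i x => ?_)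
      (fun i => ?_) ?_ hη h
    · have := derivation_comm_of_adjoin htop (δ i) (-t • D) (fun a => ?_) (fun s hs => ?_) x
      · simpa only [Derivation.smul_apply, smul_eq_mul] using this
      · simp only [Derivation.smul_apply, smul_eq_mul, hδL, hDC, mul_zero, map_zero]
      · rw [Set.mem_singleton_iff.1 hs]
        simp only [Derivation.smul_apply, smul_eq_mul, hDt, mul_one, htb, Derivation.leibniz,
          map_neg]
        rw [hδL, hDC]
        ring
    · rw [htb]
      field_simp
    · rw [hDC, hDt]
      field_simp
      simp

end LogForm

section Steps

variable {K U ι : Type*} [Field K] [Field U] [Algebra K U]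

/-- The restriction of a derivation to an intermediate field that it preserves. -/
def restrictDerivation (L : IntermediateField K U) (d : Derivation ℤ U U)
    (h : ∀ x ∈ L, d x ∈ L) : Derivation ℤ L L :=
  Derivation.mk'
    ({ toFun := fun f => ⟨d f, h f f.2⟩
       map_zero' := by ext; simp
       map_add' := fun a b => by ext; simp } : L →+ L).toIntLinearMap
    (fun a b => by ext; simp)

theorem coe_restrictDerivation (L : IntermediateField K U) (d : Derivation ℤ U U)
    (h : ∀ x ∈ L, d x ∈ L) (x : L) : (restrictDerivation L d h x : U) = d x := rfl

theorem derivation_mem_adjoin {L : IntermediateField K U} {d : Derivation ℤ U U}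
    (hL : ∀ x ∈ L, d x ∈ L) {S : Set U} (hS : ∀ s ∈ S, d s ∈ IntermediateField.adjoin L S) :
    ∀ x ∈ IntermediateField.adjoin L S, d x ∈ IntermediateField.adjoin L S := by
  intro x hx
  induction hx using IntermediateField.adjoin_induction with
  | mem x hx => exact hS x hx
  | algebraMap a => exact IntermediateField.algebraMap_mem _ (⟨d a, hL a a.2⟩ : L)
  | add x y _ _ hx hy => rw [map_add]; exact add_mem hx hy
  | inv x hx' hx =>
    rw [Derivation.leibniz_inv]
    exact mul_mem (neg_mem (pow_mem (inv_mem hx') 2)) hx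
  | mul x y hx' hy' hx hy =>
    rw [Derivation.leibniz]
    exact add_mem (mul_mem hx' hy) (mul_mem hy' hx)

open IntermediateField in
/-- For `t` transcendental over `L`, the field `L(t)` is the fraction field of `L[X]`. -/
theorem exists_polynomial_algebra_adjoin {L U : Type*} [Field L] [Field U] [Algebra L U] {t : U}
    (ht : Transcendental L t) : ∃ _ : Algebra L[X] L⟮t⟯,
      algebraMap L[X] L⟮t⟯ Polynomial.X = AdjoinSimple.gen L t ∧ IsScalarTower L L[X] L⟮t⟯ ∧
        IsFractionRing L[X] L⟮t⟯ := by
  let e := RatFunc.algEquivOfTranscendental t ht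
  let _ : Algebra L[X] L⟮t⟯ := (Polynomial.aeval (AdjoinSimple.gen L t)).toAlgebra
  have he : ∀ p : L[X], e (algebraMap L[X] (RatFunc L) p) = algebraMap L[X] L⟮t⟯ p := fun p =>
    RatFunc.algEquivOfTranscendental_algebraMap t ht p
  let e' : RatFunc L ≃ₐ[L[X]] L⟮t⟯ := AlgEquiv.ofRingEquiv (f := e.toRingEquiv) he
  exact ⟨inferInstance, Polynomial.aeval_X _,
    IsScalarTower.of_algebraMap_eq fun x => (Polynomial.aeval_C (AdjoinSimple.gen L t) x).symm,
    IsLocalization.isLocalization_of_algEquiv _ e'⟩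

open IntermediateField in
/-- Descent of logarithmic forms from `L(t)` to `L`, for `t` a transcendental logarithm or
exponential over `L`, if `L` contains all constants. -/
theorem IsLogForm.of_transcendental [CharZero U] (δ : ι → Derivation ℤ U U)
    (L : IntermediateField K U) (hL : ∀ i, ∀ x ∈ L, δ i x ∈ L)
    (hconst : ∀ x, (∀ i, δ i x = 0) → x ∈ L) {t : U} (ht : Transcendental L t)
    (hcase : (∃ b ∈ L, b ≠ 0 ∧ ∀ i, δ i t = δ i b / b) ∨ (∃ b ∈ L, ∀ i, δ i t = t * δ i b))
    {η : ι → U} (hη : ∀ i, η i ∈ L) (h : IsLogForm δ (L⟮t⟯ : Set U) η) :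
    IsLogForm δ (L : Set U) η := by
  have hLt : ∀ x ∈ L, x ∈ L⟮t⟯ := fun x hx => IntermediateField.algebraMap_mem _ (⟨x, hx⟩ : L)
  have htm : t ∈ L⟮t⟯ := mem_adjoin_simple_self L t
  have hst : ∀ i, ∀ x ∈ L⟮t⟯, δ i x ∈ L⟮t⟯ := by
    intro i
    refine derivation_mem_adjoin (hL i) ?_
    rintro s rfl
    rcases hcase with ⟨b, hb, -, h⟩ | ⟨b, hb, h⟩
    · rw [h]
      exact div_mem (hLt _ (hL i b hb)) (hLt _ hb)
    · rw [h]
      exact mul_mem htm (hLt _ (hL i b hb))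
  have hchar : CharZero L := inferInstance
  obtain ⟨_, hX, _, _⟩ := exists_polynomial_algebra_adjoin ht
  let δ' : ι → Derivation ℤ L⟮t⟯ L⟮t⟯ := fun i => restrictDerivation _ (δ i) (hst i)
  let η' : ι → L⟮t⟯ := fun i => ⟨η i, hLt _ (hη i)⟩
  have hform : IsLogForm δ' Set.univ η' := by
    obtain ⟨J, _, c, b, a, ha, hc, hb, hf⟩ := h
    refine ⟨J, inferInstance, fun j => ⟨c j, hLt _ (hconst _ (hc j))⟩, fun j => ⟨b j, (hb j).1⟩,
      ⟨a, ha⟩, trivial, fun j i => Subtype.ext (hc j i),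
      fun j => ⟨trivial, fun h0 => (hb j).2 (congrArg Subtype.val h0)⟩, fun i => Subtype.ext ?_⟩
    refine (hf i).trans ?_
    simp [δ', coe_restrictDerivation]
  have hcase' : (∃ b : L, b ≠ 0 ∧ ∀ i, δ' i (AdjoinSimple.gen L t) =
      δ' i (algebraMap L L⟮t⟯ b) / algebraMap L L⟮t⟯ b) ∨
      ∃ b : L, ∀ i, δ' i (AdjoinSimple.gen L t) =
        AdjoinSimple.gen L t * δ' i (algebraMap L L⟮t⟯ b) := by
    rcases hcase with ⟨b, hb, hb0, htb⟩ | ⟨b, hb, htb⟩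
    · exact Or.inl ⟨⟨b, hb⟩, fun h0 => hb0 (congrArg Subtype.val h0),
        fun i => Subtype.ext (htb i)⟩
    · exact Or.inr ⟨⟨b, hb⟩, fun i => Subtype.ext (htb i)⟩
  have hres := IsLogForm.descend_log_or_exp δ'
    (fun i c => ⟨⟨δ i c, hL i c c.2⟩, rfl⟩)
    (fun x hx => ⟨⟨x, hconst x fun i => congrArg Subtype.val (hx i)⟩, rfl⟩) hX hcase'
    (fun i => ⟨⟨η i, hη i⟩, rfl⟩) hform
  obtain ⟨J, _, c, b, a, ⟨a', rfl⟩, hc, hb, hf⟩ := hres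
  choose hb hb0 using hb
  choose b' hb' using hb
  refine ⟨J, inferInstance, fun j => c j, fun j => b' j, a', a'.2,
    fun j i => congrArg Subtype.val (hc j i), fun j => ⟨(b' j).2, fun h0 =>
      hb0 j (by rw [← hb']; exact Subtype.ext h0)⟩, fun i => ?_⟩
  have := congrArg Subtype.val (hf i)
  simp only [← hb'] at this
  simpa [δ', coe_restrictDerivation] using this

end Steps

/-! ### Algebraic extensions and elementary towers -/

section Algebraic

variable {K U ι : Type*} [Field K] [Field U] [Algebra K U] [CharZero U]

theorem derivation_mem_of_finiteDimensional (L : IntermediateField K U) (d : Derivation ℤ U U)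
    (hL : ∀ x ∈ L, d x ∈ L) (M : IntermediateField L U) [FiniteDimensional L M] {x : U}
    (hx : x ∈ M) : d x ∈ M := by
  let _ : Differential U := ⟨d⟩
  let _ : Differential L := ⟨restrictDerivation L d hL⟩
  have : DifferentialAlgebra L U := ⟨fun _ => rfl⟩
  have h := DifferentialAlgebra.deriv_algebraMap (A := M) (B := U) ⟨x, hx⟩
  change d x = _ at h
  rw [h]
  exact Subtype.property _

/-- Averaging a logarithmic form over the embeddings of a finite extension `M` of `L`. -/
theorem exists_sum_embeddings [IsAlgClosed U] (δ : ι → Derivation ℤ U U)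
    (L : IntermediateField K U) (hL : ∀ i, ∀ x ∈ L, δ i x ∈ L) (M : IntermediateField L U)
    [FiniteDimensional L M] {J : Type*} [Fintype J] (c b : J → M) (a : M) {η : ι → U}
    (hη : ∀ i, η i ∈ L) (h : ∀ i, η i = δ i a + ∑ j, c j * (δ i (b j) / b j)) :
    ∃ a₀ ∈ L, ∀ i, η i = δ i a₀ + ∑ j, ∑ σ : M →ₐ[L] U,
      σ (c j) / (Module.finrank L M : U) * (δ i (σ (b j)) / σ (b j)) := by
  have hst : ∀ i, ∀ x ∈ M, δ i x ∈ M := fun i x hx =>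
    derivation_mem_of_finiteDimensional L (δ i) (hL i) M hx
  have hσ : ∀ (σ : M →ₐ[L] U) i (x : M), σ (restrictDerivation M (δ i) (hst i) x) = δ i (σ x) :=
    fun σ i x => algHom_derivation (restrictDerivation L (δ i) (hL i))
      (restrictDerivation M (δ i) (hst i)) (δ i) (fun _ => rfl) (fun _ => rfl) σ x
  have hN : (Module.finrank L M : U) ≠ 0 := Nat.cast_ne_zero.2 Module.finrank_pos.ne'
  have hsum : ∀ (σ : M →ₐ[L] U) i,
      η i = δ i (σ a) + ∑ j, σ (c j) * (δ i (σ (b j)) / σ (b j)) := by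
    intro σ i
    have h1 : algebraMap L M ⟨η i, hη i⟩ = restrictDerivation M (δ i) (hst i) a +
        ∑ j, c j * (restrictDerivation M (δ i) (hst i) (b j) / b j) := by
      apply Subtype.ext
      refine (h i).trans ?_
      simp [coe_restrictDerivation]
    have h2 := congrArg σ h1
    rw [AlgHom.commutes] at h2
    simp only [map_add, map_sum, map_mul, map_div₀, hσ] at h2
    exact h2
  refine ⟨algebraMap L U (Algebra.trace L M a) / (Module.finrank L M : U),
    div_mem (Subtype.property _) (natCast_mem _ _), fun i => ?_⟩
  rw [Derivation.leibniz_div_const _ _ _ (Derivation.map_natCast _ _), trace_eq_sum_embeddings U,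
    map_sum, smul_eq_mul]
  have h3 : ∑ _σ : M →ₐ[L] U, η i = (Module.finrank L M : U) * η i := by
    rw [Finset.sum_const, Finset.card_univ, AlgHom.card, nsmul_eq_mul]
  rw [Finset.sum_congr rfl fun σ _ => hsum σ i, Finset.sum_add_distrib] at h3
  apply mul_left_cancel₀ hN
  rw [← h3, mul_add, mul_inv_cancel_left₀ hN, Finset.sum_comm, Finset.mul_sum]
  congr 1
  refine Finset.sum_congr rfl fun σ _ => ?_
  rw [Finset.mul_sum]
  refine Finset.sum_congr rfl fun j _ => ?_
  field_simp

open IntermediateField in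
/-- Descent of logarithmic forms along finite extensions of a field containing all constants:
take traces and norms. -/
theorem IsLogForm.of_isAlgebraic [IsAlgClosed U] (δ : ι → Derivation ℤ U U)
    (L : IntermediateField K U) (hL : ∀ i, ∀ x ∈ L, δ i x ∈ L)
    (hconst : ∀ x, (∀ i, δ i x = 0) → x ∈ L) {t : U} (ht : IsAlgebraic L t)
    {η : ι → U} (hη : ∀ i, η i ∈ L) (h : IsLogForm δ (L⟮t⟯ : Set U) η) :
    IsLogForm δ (L : Set U) η := by
  obtain ⟨J, _, c, b, a, ha, hc, hb, hf⟩ := h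
  have : FiniteDimensional L L⟮t⟯ := adjoin.finiteDimensional ht.isIntegral
  let c' : J → L := fun j => ⟨c j, hconst _ (hc j)⟩
  let b' : J → L⟮t⟯ := fun j => ⟨b j, (hb j).1⟩
  obtain ⟨a₀, ha₀, hf₀⟩ := exists_sum_embeddings δ L hL L⟮t⟯ (fun j => algebraMap L L⟮t⟯ (c' j))
    b' ⟨a, ha⟩ hη hf
  have hb0 : ∀ j, b' j ≠ 0 := fun j h0 => (hb j).2 (congrArg Subtype.val h0)
  have hnorm : ∀ j, algebraMap L U (Algebra.norm L (b' j)) = ∏ σ : L⟮t⟯ →ₐ[L] U, σ (b' j) :=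
    fun j => Algebra.norm_eq_prod_embeddings L U (b' j)
  have hσ0 : ∀ (σ : L⟮t⟯ →ₐ[L] U) j, σ (b' j) ≠ 0 := fun σ j =>
    (map_ne_zero_iff σ σ.injective).2 (hb0 j)
  refine ⟨J, inferInstance, fun j => c j / (Module.finrank L L⟮t⟯ : U),
    fun j => algebraMap L U (Algebra.norm L (b' j)), a₀, ha₀, fun j i => ?_,
    fun j => ⟨Subtype.property _, ?_⟩, fun i => ?_⟩
  · rw [Derivation.leibniz_div_const _ _ _ (Derivation.map_natCast _ _), hc j, smul_zero]
  · exact (hnorm j).trans_ne (Finset.prod_ne_zero_iff.2 fun σ _ => hσ0 σ j)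
  · rw [hf₀ i]
    congr 1
    refine Finset.sum_congr rfl fun j _ => ?_
    beta_reduce
    rw [hnorm, derivation_prod_div _ _ _ fun σ => hσ0 σ j, Finset.mul_sum]
    refine Finset.sum_congr rfl fun σ _ => ?_
    rw [AlgHom.commutes]
    rfl

open IntermediateField in
/-- Descent along one step of an elementary tower over a field containing all constants. -/
theorem IsLogForm.of_elementary_step [IsAlgClosed U] (δ : ι → Derivation ℤ U U)
    (L : IntermediateField K U) (hL : ∀ i, ∀ x ∈ L, δ i x ∈ L)
    (hconst : ∀ x, (∀ i, δ i x = 0) → x ∈ L) {t : U}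
    (ht : IsAlgebraic L t ∨ (∃ b ∈ L, b ≠ 0 ∧ ∀ i, δ i t = δ i b / b) ∨
      ∃ b ∈ L, ∀ i, δ i t = t * δ i b)
    {η : ι → U} (hη : ∀ i, η i ∈ L) (h : IsLogForm δ (L⟮t⟯ : Set U) η) :
    IsLogForm δ (L : Set U) η := by
  by_cases halg : IsAlgebraic L t
  · exact h.of_isAlgebraic δ L hL hconst halg hη
  · exact h.of_transcendental δ L hL hconst halg (ht.resolve_left halg) hη

open IntermediateField in
theorem derivation_mem_adjoin_of_elementary_step (δ : ι → Derivation ℤ U U)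
    (L : IntermediateField K U) (hL : ∀ i, ∀ x ∈ L, δ i x ∈ L) {t : U}
    (ht : IsAlgebraic L t ∨ (∃ b ∈ L, b ≠ 0 ∧ ∀ i, δ i t = δ i b / b) ∨
      ∃ b ∈ L, ∀ i, δ i t = t * δ i b) (i : ι) : ∀ x ∈ L⟮t⟯, δ i x ∈ L⟮t⟯ := by
  have hLt : ∀ x ∈ L, x ∈ L⟮t⟯ := fun x hx => IntermediateField.algebraMap_mem _ (⟨x, hx⟩ : L)
  rcases ht with ht | ⟨b, hb, -, h⟩ | ⟨b, hb, h⟩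
  · have : FiniteDimensional L L⟮t⟯ := adjoin.finiteDimensional ht.isIntegral
    exact fun x hx => derivation_mem_of_finiteDimensional L (δ i) (hL i) L⟮t⟯ hx
  · refine derivation_mem_adjoin (hL i) ?_
    rintro s rfl
    rw [h]
    exact div_mem (hLt _ (hL i b hb)) (hLt _ hb)
  · refine derivation_mem_adjoin (hL i) ?_
    rintro s rfl
    rw [h]
    exact mul_mem (mem_adjoin_simple_self L s) (hLt _ (hL i b hb))

open IntermediateField in
/-- Descent of logarithmic forms along an elementary tower `L(t₁, …, t_n)` over a field `L`
containing all constants. -/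
theorem IsLogForm.of_elementary_tower [IsAlgClosed U] (δ : ι → Derivation ℤ U U) {n : ℕ}
    (t : ℕ → U) (L : IntermediateField K U) (hL : ∀ i, ∀ x ∈ L, δ i x ∈ L)
    (hconst : ∀ x, (∀ i, δ i x = 0) → x ∈ L)
    (ht : ∀ j < n, ∀ M : IntermediateField K U, L ≤ M → (∀ l < j, t l ∈ M) →
      IsAlgebraic M (t j) ∨ (∃ b ∈ M, b ≠ 0 ∧ ∀ i, δ i (t j) = δ i b / b) ∨
      ∃ b ∈ M, ∀ i, δ i (t j) = t j * δ i b)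
    {η : ι → U} (hη : ∀ i, η i ∈ L) (E : IntermediateField K U)
    (hE : E ≤ L ⊔ adjoin K (t '' {l | l < n}))
    (h : IsLogForm δ (E : Set U) η) : IsLogForm δ (L : Set U) η := by
  induction n generalizing L t with
  | zero =>
    obtain ⟨J, _, c, b, a, ha, hc, hb, hf⟩ := h
    have hEL : E ≤ L := by simpa using hE
    exact ⟨J, inferInstance, c, b, a, hEL ha, hc, fun j => ⟨hEL (hb j).1, (hb j).2⟩, hf⟩
  | succ n ih =>
    -- Pass to the tower of length `n` over `L(t₁)`.
    have h0 := ht 0 n.succ_pos L le_rfl (by simp)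
    let L' : IntermediateField K U := L⟮t 0⟯.restrictScalars K
    have hLL' : L ≤ L' := fun x hx => IntermediateField.algebraMap_mem L⟮t 0⟯ (⟨x, hx⟩ : L)
    have h0L' : t 0 ∈ L' := mem_adjoin_simple_self L (t 0)
    have hstep : IsLogForm δ (L' : Set U) η := by
      refine ih (fun l => t (l + 1)) L'
        (fun i => derivation_mem_adjoin_of_elementary_step δ L hL h0 i)
        (fun x hx => hLL' (hconst x hx)) (fun j hj M hM hl => ?_) (fun i => hLL' (hη i))
        (hE.trans ?_)
      · refine ht (j + 1) (by omega) M (hLL'.trans hM) fun l hlj => ?_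
        rcases l with _ | l
        · exact hM h0L'
        · exact hl l (by omega)
      · refine sup_le (hLL'.trans le_sup_left) (adjoin_le_iff.2 ?_)
        rintro _ ⟨l, hl, rfl⟩
        rcases l with _ | l
        · exact (le_sup_left : L' ≤ _) h0L'
        · refine (le_sup_right : _ ≤ L' ⊔ _) (subset_adjoin K _ ⟨l, ?_, rfl⟩)
          simpa using hl
    exact hstep.of_elementary_step δ L hL hconst h0 hη

end Algebraic

/-! ### Linear disjointness of constants -/

section Constants

variable {C F U ι : Type*} [Field C] [Field F] [Field U] [Algebra C F] [Algebra F U] [Algebra C U]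
  [IsScalarTower C F U]

/-- Constants that are linearly independent over the constants of `F` are linearly independent
over `F`: differentiate a shortest relation in which one coefficient is `1`. -/
theorem linearIndependent_of_constants {δ : ι → Derivation ℤ U U}
    (hF : ∀ i (x : F), ∃ y : F, δ i (algebraMap F U x) = algebraMap F U y)
    (hC : ∀ x : F, (∀ i, δ i (algebraMap F U x) = 0) → x ∈ Set.range (algebraMap C F))
    {κ : Type*} {u : κ → U} (hu : ∀ k i, δ i (u k) = 0) (hlin : LinearIndependent C u) :
    LinearIndependent F u := by
  classical
  choose dF hdF using hF
  rw [linearIndependent_iff'] at hlin ⊢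
  intro s
  induction s using Finset.strongInduction with
  | H s ih =>
    intro g hg
    by_contra! hne
    obtain ⟨k, hks, hk⟩ := hne
    let h : κ → F := fun j => g j / g k
    have hhk : h k = 1 := div_self hk
    have hsum : ∑ j ∈ s, algebraMap F U (h j) * u j = 0 := by
      have : ∑ j ∈ s, algebraMap F U (h j) * u j =
          (algebraMap F U (g k))⁻¹ * ∑ j ∈ s, g j • u j := by
        rw [Finset.mul_sum]
        refine Finset.sum_congr rfl fun j _ => ?_
        rw [Algebra.smul_def, map_div₀]
        ring
      rw [this, hg, mul_zero]
    have hd : ∀ i, ∀ j ∈ s, δ i (algebraMap F U (h j)) = 0 := by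
      intro i
      have h1 : ∑ j ∈ s, δ i (algebraMap F U (h j)) * u j = 0 := by
        have := congrArg (δ i) hsum
        rw [map_sum, map_zero] at this
        rw [← this]
        refine Finset.sum_congr rfl fun j _ => ?_
        rw [Derivation.leibniz, hu, smul_zero, zero_add, smul_eq_mul, mul_comm]
      have hk0 : δ i (algebraMap F U (h k)) = 0 := by
        rw [hhk, map_one, Derivation.map_one_eq_zero]
      rw [← Finset.sum_erase s (a := k) (by rw [hk0, zero_mul])] at h1
      intro j hj
      by_cases hjk : j = k
      · rw [hjk, hk0]
      · rw [hdF, ih _ (Finset.erase_ssubset hks) (fun j => dF i (h j))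
          (by simpa only [Algebra.smul_def, hdF] using h1) j (Finset.mem_erase.2 ⟨hjk, hj⟩),
          map_zero]
    have hc : ∀ j, ∃ c : C, j ∈ s → algebraMap C F c = h j := fun j => by
      by_cases hj : j ∈ s
      · obtain ⟨c, hc⟩ := hC (h j) fun i => hd i j hj
        exact ⟨c, fun _ => hc⟩
      · exact ⟨0, fun h => absurd h hj⟩
    choose c hc using hc
    have hc0 : c k = 0 := by
      refine hlin s c ?_ k hks
      rw [← hsum]
      refine Finset.sum_congr rfl fun j hj => ?_
      rw [← hc j hj, Algebra.smul_def, IsScalarTower.algebraMap_apply C F U]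
    have := hc k hks
    rw [hc0, map_zero, hhk] at this
    exact zero_ne_one this

/-- The map `F ⊗ A → U`, `f ⊗ a ↦ f φ(a)`. -/
noncomputable def scalarExtension (F : Type*) [Field F] [Algebra C F] [Algebra F U]
    [IsScalarTower C F U] {A : Type*} [CommRing A] [Algebra C A] (φ : A →ₐ[C] U) :
    F ⊗[C] A →ₐ[F] U :=
  Algebra.TensorProduct.productLeftAlgHom (Algebra.ofId F U) φ

variable {A : Type*} [CommRing A] [Algebra C A]

theorem scalarExtension_tmul (φ : A →ₐ[C] U) (f : F) (a : A) :
    scalarExtension F φ (f ⊗ₜ a) = algebraMap F U f * φ a := by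
  simp [scalarExtension, Algebra.ofId_apply]

/-- Linear disjointness of `F` and the constants of `U` over the constants of `F`. -/
theorem scalarExtension_injective {δ : ι → Derivation ℤ U U}
    (hF : ∀ i (x : F), ∃ y : F, δ i (algebraMap F U x) = algebraMap F U y)
    (hC : ∀ x : F, (∀ i, δ i (algebraMap F U x) = 0) → x ∈ Set.range (algebraMap C F))
    (φ : A →ₐ[C] U) (hφ : Function.Injective φ) (hconst : ∀ i a, δ i (φ a) = 0) :
    Function.Injective (scalarExtension F φ) := by
  let B := Module.Free.chooseBasis C A
  let B' := Algebra.TensorProduct.basis F B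
  have hlin : LinearIndependent F fun k => φ (B k) :=
    linearIndependent_of_constants hF hC (fun k i => hconst i _)
      (B.linearIndependent.map' φ.toLinearMap (LinearMap.ker_eq_bot.2 hφ))
  rw [injective_iff_map_eq_zero]
  intro x hx
  have h1 : scalarExtension F φ x = Finsupp.linearCombination F (fun k => φ (B k)) (B'.repr x) := by
    have h2 : (scalarExtension F φ).toLinearMap =
        (Finsupp.linearCombination F fun k => φ (B k)) ∘ₗ B'.repr.toLinearMap := by
      refine B'.ext fun k => ?_
      simp [B', scalarExtension_tmul]
    exact LinearMap.congr_fun h2 x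
  rw [h1] at hx
  have h3 := (linearIndependent_iff.1 hlin) _ hx
  exact B'.repr.map_eq_zero_iff.1 h3

/-- An algebraic element over a field of constants is a constant. -/
theorem derivation_eq_zero_of_isAlgebraic [CharZero C] {d : Derivation ℤ U U}
    (hd : ∀ c, d (algebraMap C U c) = 0) {x : U} (hx : IsAlgebraic C x) : d x = 0 := by
  let R := IntermediateField.adjoin C {x}
  have : Algebra.IsAlgebraic C R := IntermediateField.isAlgebraic_adjoin_simple hx.isIntegral
  have := algHom_derivation (0 : Derivation ℤ C C) (0 : Derivation ℤ R R) d (by simp) (by simpa)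
    R.val (IntermediateField.AdjoinSimple.gen C x)
  simpa using this.symm

/-- A form of the Nullstellensatz: a finitely generated algebra has an algebraic point outside
the zero set of a given nonzero element. -/
theorem exists_algHom_ne_zero [IsAlgClosed U] [IsDomain A] [Algebra.FiniteType C A] {h : A}
    (hh : h ≠ 0) : ∃ φ : A →ₐ[C] U, φ h ≠ 0 ∧ ∀ a, IsAlgebraic C (φ a) := by
  let B := Localization.Away h
  have : Nontrivial B := (IsLocalization.injective B
    (powers_le_nonZeroDivisors_of_noZeroDivisors hh)).nontrivial
  obtain ⟨m, hm⟩ := Ideal.exists_maximal B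
  let _ : Field (B ⧸ m) := Ideal.Quotient.field m
  have : Algebra.FiniteType A B := IsLocalization.finiteType_of_monoid_fg (Submonoid.powers h) B
  have : Algebra.FiniteType C B := Algebra.FiniteType.trans (S := A) inferInstance inferInstance
  have : Algebra.FiniteType C (B ⧸ m) := inferInstance
  have : Module.Finite C (B ⧸ m) := finite_of_finite_type_of_isJacobsonRing C (B ⧸ m)
  let ψ : (B ⧸ m) →ₐ[C] U := IsAlgClosed.lift
  refine ⟨ψ.comp ((Ideal.Quotient.mkₐ C m).comp (IsScalarTower.toAlgHom C A B)), ?_, fun a => ?_⟩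
  · have hu : IsUnit (algebraMap A B h) := IsLocalization.Away.algebraMap_isUnit h
    exact ((hu.map (Ideal.Quotient.mkₐ C m)).map ψ).ne_zero
  · exact (Algebra.IsAlgebraic.isAlgebraic _).algHom ψ

/-- A nonzero element `s` of `F ⊗ A` does not vanish at any constant point `φ` of `A` with
`φ h ≠ 0`, where `h` is a nonzero coordinate of `s` with respect to a basis of `F` over `C`: this
basis remains linearly independent over the constants of `U`. -/
theorem exists_scalarExtension_ne_zero {δ : ι → Derivation ℤ U U}
    (hF : ∀ i (x : F), ∃ y : F, δ i (algebraMap F U x) = algebraMap F U y)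
    (hC : ∀ x : F, (∀ i, δ i (algebraMap F U x) = 0) → x ∈ Set.range (algebraMap C F))
    {s : F ⊗[C] A} (hs : s ≠ 0) :
    ∃ h : A, h ≠ 0 ∧ ∀ φ : A →ₐ[C] U, (∀ i a, δ i (φ a) = 0) → φ h ≠ 0 →
      scalarExtension F φ s ≠ 0 := by
  let B := Module.Free.chooseBasis C F
  obtain ⟨k, hk⟩ : ∃ k, TensorProduct.equivFinsuppOfBasisLeft B s k ≠ 0 := by
    by_contra! h0
    exact hs ((TensorProduct.equivFinsuppOfBasisLeft B).map_eq_zero_iff.1 (Finsupp.ext h0))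
  refine ⟨_, hk, fun φ hφ hφh hzero => ?_⟩
  have hinj := scalarExtension_injective hF hC φ.range.val Subtype.val_injective (by
    rintro i ⟨_, a, rfl⟩
    exact hφ i a)
  have h1 : ∀ x : F ⊗[C] A, scalarExtension F φ.range.val
      (Algebra.TensorProduct.map (AlgHom.id F F) φ.rangeRestrict x) = scalarExtension F φ x := by
    intro x
    induction x with
    | zero => simp
    | add x y hx hy => rw [map_add, map_add, map_add, hx, hy]
    | tmul f a => simp [scalarExtension_tmul]
  have h2 : ∀ x : F ⊗[C] A, TensorProduct.equivFinsuppOfBasisLeft B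
      (Algebra.TensorProduct.map (AlgHom.id F F) φ.rangeRestrict x) k =
      φ.rangeRestrict (TensorProduct.equivFinsuppOfBasisLeft B x k) := by
    intro x
    induction x with
    | zero => simp
    | add x y hx hy => simp only [map_add, Finsupp.add_apply, hx, hy]
    | tmul f a => simp
  rw [← h1] at hzero
  have h3 := (injective_iff_map_eq_zero _).1 hinj _ hzero
  have h4 := h2 s
  rw [h3, map_zero, Finsupp.zero_apply] at h4
  exact hφh (congrArg Subtype.val h4).symm

end Constants

/-! ### Specialization of constants -/

section FracRel

variable {T U ι : Type*} [CommRing T] [Field U]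

/-- The specialization of fractions induced by two homomorphisms `θ, ψ : T → U`: the elements
`u = θ x / θ s` and `w = ψ x / ψ s` are related. For injective `θ` this is the graph of the
extension of `ψ ∘ θ⁻¹` to the local ring of fractions at the kernel of `ψ`. -/
def FracRel (θ ψ : T →+* U) (u w : U) : Prop :=
  ∃ x s : T, θ s ≠ 0 ∧ ψ s ≠ 0 ∧ u = θ x / θ s ∧ w = ψ x / ψ s

variable {θ ψ : T →+* U} {u w u' w' : U}

theorem FracRel.of_map (x : T) : FracRel θ ψ (θ x) (ψ x) :=
  ⟨x, 1, by simp, by simp, by simp, by simp⟩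

theorem FracRel.add (h : FracRel θ ψ u w) (h' : FracRel θ ψ u' w') :
    FracRel θ ψ (u + u') (w + w') := by
  obtain ⟨x, s, h1, h2, rfl, rfl⟩ := h
  obtain ⟨x', s', h1', h2', rfl, rfl⟩ := h'
  exact ⟨x * s' + s * x', s * s', by simp [h1, h1'], by simp [h2, h2'],
    by simp [div_add_div _ _ h1 h1'], by simp [div_add_div _ _ h2 h2']⟩

theorem FracRel.mul (h : FracRel θ ψ u w) (h' : FracRel θ ψ u' w') :
    FracRel θ ψ (u * u') (w * w') := by
  obtain ⟨x, s, h1, h2, rfl, rfl⟩ := h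
  obtain ⟨x', s', h1', h2', rfl, rfl⟩ := h'
  exact ⟨x * x', s * s', by simp [h1, h1'], by simp [h2, h2'],
    by simp [div_mul_div_comm], by simp [div_mul_div_comm]⟩

theorem FracRel.sum {J : Type*} (S : Finset J) {u w : J → U} (h : ∀ j, FracRel θ ψ (u j) (w j)) :
    FracRel θ ψ (∑ j ∈ S, u j) (∑ j ∈ S, w j) := by
  classical
  induction S using Finset.induction_on with
  | empty => simpa using FracRel.of_map (θ := θ) (ψ := ψ) 0
  | insert j S hj ih =>
    rw [Finset.sum_insert hj, Finset.sum_insert hj]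
    exact (h j).add ih

theorem FracRel.div (hθ : Function.Injective θ) (h : FracRel θ ψ u w)
    (h' : FracRel θ ψ u' w') (hw' : w' ≠ 0) : FracRel θ ψ (u / u') (w / w') := by
  obtain ⟨x, s, h1, h2, rfl, rfl⟩ := h
  obtain ⟨x', s', h1', h2', rfl, rfl⟩ := h'
  have hx' : ψ x' ≠ 0 := fun h0 => hw' (by rw [h0, zero_div])
  have hx'' : θ x' ≠ 0 := fun h0 => hx' (by
    rw [(injective_iff_map_eq_zero θ).1 hθ x' h0, map_zero])
  exact ⟨x * s', s * x', by simp [h1, hx''], by simp [h2, hx'],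
    by simp [div_div_div_eq], by simp [div_div_div_eq]⟩

theorem FracRel.unique (hθ : Function.Injective θ) (h : FracRel θ ψ u w)
    (h' : FracRel θ ψ u w') : w = w' := by
  obtain ⟨x, s, h1, h2, rfl, rfl⟩ := h
  obtain ⟨x', s', h1', h2', he, rfl⟩ := h'
  rw [div_eq_div_iff h1 h1', ← map_mul, ← map_mul] at he
  rw [div_eq_div_iff h2 h2', ← map_mul, ← map_mul, hθ he]

theorem FracRel.derivation {d : Derivation ℤ U U}
    (hd : ∀ x, ∃ y, θ y = d (θ x) ∧ ψ y = d (ψ x)) (h : FracRel θ ψ u w) :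
    FracRel θ ψ (d u) (d w) := by
  obtain ⟨x, s, h1, h2, rfl, rfl⟩ := h
  obtain ⟨x', hx1, hx2⟩ := hd x
  obtain ⟨s', hs1, hs2⟩ := hd s
  refine ⟨s * x' - x * s', s * s, by simp [h1], by simp [h2], ?_, ?_⟩
  · rw [Derivation.leibniz_div, ← hx1, ← hs1]
    simp only [map_sub, map_mul, smul_eq_mul]
    field_simp
  · rw [Derivation.leibniz_div, ← hx2, ← hs2]
    simp only [map_sub, map_mul, smul_eq_mul]
    field_simp

end FracRel

section Specialization

variable {C F U ι : Type*} [Field C] [Field F] [Field U] [Algebra C F] [Algebra F U] [Algebra C U]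
  [IsScalarTower C F U]

/-- Elements of `F(S)` are fractions of elements of the image of `F ⊗ C[S]`. -/
theorem exists_eq_div_of_mem_adjoin {S : Set U} {x : U} (hx : x ∈ IntermediateField.adjoin F S) :
    ∃ r s : F ⊗[C] Algebra.adjoin C S, scalarExtension F (Algebra.adjoin C S).val s ≠ 0 ∧
      x = scalarExtension F (Algebra.adjoin C S).val r /
        scalarExtension F (Algebra.adjoin C S).val s := by
  have key : Algebra.adjoin F S ≤ (scalarExtension F (Algebra.adjoin C S).val).range := by
    refine Algebra.adjoin_le fun s hs => ⟨1 ⊗ₜ ⟨s, Algebra.subset_adjoin hs⟩, ?_⟩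
    simp [scalarExtension_tmul]
  obtain ⟨r, hr, s, hs, rfl⟩ := IntermediateField.mem_adjoin_iff_div.1 hx
  obtain ⟨r', rfl⟩ := key hr
  obtain ⟨s', rfl⟩ := key hs
  by_cases h0 : scalarExtension F (Algebra.adjoin C S).val s' = 0
  · refine ⟨0, 1, by simp, ?_⟩
    rw [map_zero, zero_div]
    exact (congrArg (_ / ·) h0).trans (div_zero _)
  · exact ⟨r', s', h0, rfl⟩

theorem scalarExtension_mem_adjoin {S : Set U} (φ : Algebra.adjoin C S →ₐ[C] U)
    (x : F ⊗[C] Algebra.adjoin C S) : scalarExtension F φ x ∈ IntermediateField.adjoin F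
      (Set.range fun s : S => φ ⟨s, Algebra.subset_adjoin s.2⟩) := by
  have key : ∀ a (ha : a ∈ Algebra.adjoin C S), φ ⟨a, ha⟩ ∈ IntermediateField.adjoin F
      (Set.range fun s : S => φ ⟨s, Algebra.subset_adjoin s.2⟩) := by
    intro a ha
    induction ha using Algebra.adjoin_induction with
    | mem a ha => exact IntermediateField.subset_adjoin F _ ⟨⟨a, ha⟩, rfl⟩
    | algebraMap c =>
      have : φ (algebraMap C (Algebra.adjoin C S) c) = algebraMap F U (algebraMap C F c) := by
        rw [AlgHom.commutes, ← IsScalarTower.algebraMap_apply]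
      exact this ▸ IntermediateField.algebraMap_mem _ _
    | add a b ha hb iha ihb =>
      have : φ ⟨a + b, add_mem ha hb⟩ = φ ⟨a, ha⟩ + φ ⟨b, hb⟩ := map_add φ ⟨a, ha⟩ ⟨b, hb⟩
      exact this ▸ add_mem iha ihb
    | mul a b ha hb iha ihb =>
      have : φ ⟨a * b, mul_mem ha hb⟩ = φ ⟨a, ha⟩ * φ ⟨b, hb⟩ := map_mul φ ⟨a, ha⟩ ⟨b, hb⟩
      exact this ▸ mul_mem iha ihb
  induction x with
  | zero => simp
  | add x y hx hy => rw [map_add]; exact add_mem hx hy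
  | tmul f a =>
    rw [scalarExtension_tmul]
    exact mul_mem (IntermediateField.algebraMap_mem _ f) (key a a.2)

theorem exists_derivation_scalarExtension {A : Type*} [CommRing A] [Algebra C A]
    {d : Derivation ℤ U U} (hF : ∀ x : F, ∃ y : F, d (algebraMap F U x) = algebraMap F U y)
    {φ φ' : A →ₐ[C] U} (hφ : ∀ a, d (φ a) = 0) (hφ' : ∀ a, d (φ' a) = 0) (x : F ⊗[C] A) :
    ∃ y, scalarExtension F φ y = d (scalarExtension F φ x) ∧
      scalarExtension F φ' y = d (scalarExtension F φ' x) := by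
  induction x with
  | zero => exact ⟨0, by simp⟩
  | add x y hx hy =>
    obtain ⟨x', hx1, hx2⟩ := hx
    obtain ⟨y', hy1, hy2⟩ := hy
    exact ⟨x' + y', by rw [map_add, map_add, map_add, hx1, hy1],
      by rw [map_add, map_add, map_add, hx2, hy2]⟩
  | tmul f a =>
    obtain ⟨y, hy⟩ := hF f
    refine ⟨y ⊗ₜ a, ?_, ?_⟩
    · rw [scalarExtension_tmul, scalarExtension_tmul, Derivation.leibniz, hφ, hy, smul_zero,
        zero_add, smul_eq_mul, mul_comm]
    · rw [scalarExtension_tmul, scalarExtension_tmul, Derivation.leibniz, hφ', hy, smul_zero,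
        zero_add, smul_eq_mul, mul_comm]

/-- Specialization of constants: a logarithmic form over `F(S)`, for a finite set `S` of
constants of `U`, specializes to one over `F(S')` for a finite set `S'` of constants algebraic
over the constants `C` of `F`. -/
theorem exists_specialization [CharZero C] [IsAlgClosed U] {δ : ι → Derivation ℤ U U}
    (hF : ∀ i (x : F), ∃ y : F, δ i (algebraMap F U x) = algebraMap F U y)
    (hCδ : ∀ i c, δ i (algebraMap C U c) = 0)
    (hC : ∀ x : F, (∀ i, δ i (algebraMap F U x) = 0) → x ∈ Set.range (algebraMap C F))
    (S : Finset U) (hS : ∀ s ∈ S, ∀ i, δ i s = 0) {J : Type*} [Fintype J] {c b : J → U} {a : U}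
    (ha : a ∈ IntermediateField.adjoin F (S : Set U)) (hc : ∀ j, c j ∈ S)
    (hb : ∀ j, b j ∈ IntermediateField.adjoin F (S : Set U)) (hb0 : ∀ j, b j ≠ 0)
    {η : ι → U} (hη : ∀ i, η i ∈ Set.range (algebraMap F U))
    (h : ∀ i, η i = δ i a + ∑ j, c j * (δ i (b j) / b j)) :
    ∃ S' : Finset U, (∀ s ∈ S', IsAlgebraic C s) ∧ ∃ (c' b' : J → U),
      ∃ a' ∈ IntermediateField.adjoin F (S' : Set U), (∀ j, c' j ∈ S') ∧
        (∀ j, b' j ∈ IntermediateField.adjoin F (S' : Set U)) ∧ (∀ j, b' j ≠ 0) ∧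
          ∀ i, η i = δ i a' + ∑ j, c' j * (δ i (b' j) / b' j) := by
  classical
  let A := Algebra.adjoin C (S : Set U)
  let θ := scalarExtension F A.val
  have hAfin : Algebra.FiniteType C A :=
    (Subalgebra.fg_iff_finiteType A).1 ⟨S, rfl⟩
  have hAconst : ∀ i (x : A), δ i (A.val x) = 0 := by
    rintro i ⟨x, hx⟩
    change δ i x = 0
    induction hx using Algebra.adjoin_induction with
    | mem x hx => exact hS x hx i
    | algebraMap c => exact hCδ i c
    | add x y _ _ hx hy => rw [map_add, hx, hy, add_zero]
    | mul x y _ _ hx hy => rw [Derivation.leibniz, hx, hy, smul_zero, smul_zero, add_zero]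
  have hθ : Function.Injective θ :=
    scalarExtension_injective hF hC A.val Subtype.val_injective hAconst
  obtain ⟨xa, sa, hsa, hxa⟩ := exists_eq_div_of_mem_adjoin (C := C) ha
  choose xb sb hsb hxb using fun j => exists_eq_div_of_mem_adjoin (C := C) (hb j)
  have hxb0 : ∀ j, θ (xb j) ≠ 0 := fun j h0 =>
    hb0 j ((hxb j).trans ((congrArg (· / _) h0).trans (zero_div _)))
  let s := sa * ∏ j, (sb j * xb j)
  have hs : s ≠ 0 := by
    intro h0
    have h1 : θ s = 0 := by rw [h0, map_zero]
    rw [map_mul, map_prod] at h1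
    refine mul_ne_zero hsa (Finset.prod_ne_zero_iff.2 fun j _ => ?_) h1
    rw [map_mul]
    exact mul_ne_zero (hsb j) (hxb0 j)
  obtain ⟨h₀, hh₀, hspec⟩ := exists_scalarExtension_ne_zero hF hC hs
  obtain ⟨φ, hφh, hφalg⟩ := exists_algHom_ne_zero (C := C) (U := U) hh₀
  have hφconst : ∀ i x, δ i (φ x) = 0 := fun i x =>
    derivation_eq_zero_of_isAlgebraic (hCδ i) (hφalg x)
  let ψ := scalarExtension F φ
  have hψs : ψ s ≠ 0 := hspec φ hφconst hφh
  have hψsa : ψ sa ≠ 0 := fun h0 => hψs (by rw [map_mul, h0, zero_mul])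
  have hψb : ∀ j, ψ (sb j) ≠ 0 ∧ ψ (xb j) ≠ 0 := by
    intro j
    have : ψ (∏ j, (sb j * xb j)) ≠ 0 := fun h0 => hψs (by rw [map_mul, h0, mul_zero])
    rw [map_prod, Finset.prod_ne_zero_iff] at this
    have := this j (Finset.mem_univ j)
    rw [map_mul] at this
    exact ⟨left_ne_zero_of_mul this, right_ne_zero_of_mul this⟩
  let S' : Finset U := Finset.univ.image fun s : S => φ ⟨s, Algebra.subset_adjoin s.2⟩
  have hS' : (S' : Set U) =
      Set.range fun s : (S : Set U) => φ ⟨s, Algebra.subset_adjoin s.2⟩ := by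
    ext u
    simp [S']
  have hψmem : ∀ x, ψ x ∈ IntermediateField.adjoin F (S' : Set U) := fun x =>
    hS' ▸ scalarExtension_mem_adjoin φ x
  have hra : FracRel θ.toRingHom ψ.toRingHom a (ψ xa / ψ sa) := ⟨xa, sa, hsa, hψsa, hxa, rfl⟩
  have hrb : ∀ j, FracRel θ.toRingHom ψ.toRingHom (b j) (ψ (xb j) / ψ (sb j)) := fun j =>
    ⟨xb j, sb j, hsb j, (hψb j).1, hxb j, rfl⟩
  have hrc : ∀ j, FracRel θ.toRingHom ψ.toRingHom (c j)
      (φ ⟨c j, Algebra.subset_adjoin (hc j)⟩) := by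
    intro j
    have := FracRel.of_map (θ := θ.toRingHom) (ψ := ψ.toRingHom)
      (1 ⊗ₜ[C] (⟨c j, Algebra.subset_adjoin (hc j)⟩ : A))
    simpa [θ, ψ, scalarExtension_tmul] using this
  have hb'0 : ∀ j, ψ (xb j) / ψ (sb j) ≠ 0 := fun j => div_ne_zero (hψb j).2 (hψb j).1
  have hd : ∀ i x, ∃ y, θ y = δ i (θ x) ∧ ψ y = δ i (ψ x) := fun i x =>
    exists_derivation_scalarExtension (hF i) (hAconst i) (hφconst i) x
  refine ⟨S', fun u hu => ?_, fun j => φ ⟨c j, Algebra.subset_adjoin (hc j)⟩,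
    fun j => ψ (xb j) / ψ (sb j), ψ xa / ψ sa, div_mem (hψmem _) (hψmem _), fun j => ?_,
    fun j => div_mem (hψmem _) (hψmem _), hb'0, fun i => ?_⟩
  · obtain ⟨s, -, rfl⟩ := Finset.mem_image.1 hu
    exact hφalg _
  · exact Finset.mem_image.2 ⟨⟨c j, hc j⟩, Finset.mem_univ _, rfl⟩
  · obtain ⟨y, hy⟩ := hη i
    have h1 : FracRel θ.toRingHom ψ.toRingHom (η i) (η i) := by
      have := FracRel.of_map (θ := θ.toRingHom) (ψ := ψ.toRingHom) (y ⊗ₜ[C] (1 : A))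
      simpa [θ, ψ, scalarExtension_tmul, hy] using this
    refine h1.unique hθ ?_
    rw [h i]
    exact (hra.derivation (hd i)).add (FracRel.sum _ fun j =>
      (hrc j).mul (((hrb j).derivation (hd i)).div hθ (hrb j) (hb'0 j)))

end Specialization

/-! ### Averaging over conjugates -/

section Conjugates

variable {K U ι : Type*} [Field K] [Field U] [Algebra K U] [CharZero U]

theorem algHom_mem_adjoin {F U : Type*} [Field F] [Field U] [Algebra F U] {S : Set U} {T : Set U}
    (σ : IntermediateField.adjoin F S →ₐ[F] U)
    (hσ : ∀ s (hs : s ∈ S), σ ⟨s, IntermediateField.subset_adjoin F S hs⟩ ∈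
      IntermediateField.adjoin F T) (x : IntermediateField.adjoin F S) :
    σ x ∈ IntermediateField.adjoin F T := by
  have h1 : IntermediateField.adjoin F S ≤
      ((IntermediateField.adjoin F T).comap σ).map (IntermediateField.adjoin F S).val := by
    rw [IntermediateField.adjoin_le_iff]
    intro s hs
    exact ⟨⟨s, IntermediateField.subset_adjoin F S hs⟩, hσ s hs, rfl⟩
  obtain ⟨y, hy, hyx⟩ := h1 x.2
  have : y = x := Subtype.ext hyx
  exact this ▸ hy

/-- A logarithmic form over `F(S)`, for a finite set `S` of constants algebraic over the constants
`C` of `F`, is averaged over the conjugates of `F(S)` to bring its exact part into `F`. Terms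
`s · d1 / 1` for the conjugates `s` of the elements of `S` make the arguments of the logarithmic
derivatives lie in the field generated by the coefficients. -/
theorem exists_form_of_algebraic_constants [IsAlgClosed U] (δ : ι → Derivation ℤ U U)
    (F : IntermediateField K U) (hF : ∀ i, ∀ x ∈ F, δ i x ∈ F) {C : Type*} [Field C] [Algebra C F]
    [Algebra C U] [IsScalarTower C F U] (S : Finset U) (hS : ∀ s ∈ S, IsAlgebraic C s)
    {J : Type*} [Fintype J] {c b : J → U} {a : U}
    (ha : a ∈ IntermediateField.adjoin F (S : Set U)) (hc : ∀ j, c j ∈ S)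
    (hb : ∀ j, b j ∈ IntermediateField.adjoin F (S : Set U)) (hb0 : ∀ j, b j ≠ 0)
    {η : ι → U} (hη : ∀ i, η i ∈ F)
    (h : ∀ i, η i = δ i a + ∑ j, c j * (δ i (b j) / b j)) :
    ∃ a₀ ∈ F, ∃ (n : ℕ) (c' b' : Fin n → U), (∀ j, IsAlgebraic C (c' j)) ∧
      (∀ j, b' j ∈ IntermediateField.adjoin F (Set.range c')) ∧ (∀ j, b' j ≠ 0) ∧
        ∀ i, η i = δ i a₀ + ∑ j, c' j * (δ i (b' j) / b' j) := by
  classical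
  let M := IntermediateField.adjoin F (S : Set U)
  have : FiniteDimensional F M := IntermediateField.finiteDimensional_adjoin fun s hs =>
    ((hS s hs).tower_top F).isIntegral
  have hSM : ∀ s ∈ S, s ∈ M := fun s hs => IntermediateField.subset_adjoin F _ hs
  obtain ⟨a₀, ha₀, hf⟩ := exists_sum_embeddings δ F hF M (fun j => ⟨c j, hSM _ (hc j)⟩)
    (fun j => ⟨b j, hb j⟩) ⟨a, ha⟩ hη h
  have halg : ∀ (σ : M →ₐ[F] U) s (hs : s ∈ S), IsAlgebraic C (σ ⟨s, hSM s hs⟩) := by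
    intro σ s hs
    obtain ⟨p, hp0, hp⟩ := hS s hs
    refine ⟨p, hp0, ?_⟩
    have h1 : Polynomial.aeval (⟨s, hSM s hs⟩ : M) (p.map (algebraMap C F)) = 0 := by
      apply (algebraMap M U).injective
      rw [← Polynomial.aeval_algebraMap_apply, map_zero, Polynomial.aeval_map_algebraMap]
      exact hp
    rw [← Polynomial.aeval_map_algebraMap F, Polynomial.aeval_algHom_apply, h1, map_zero]
  let I := (J × (M →ₐ[F] U)) ⊕ (S × (M →ₐ[F] U))
  let c₁ : I → U := Sum.elim
    (fun x => x.2 ⟨c x.1, hSM _ (hc x.1)⟩ / (Module.finrank F M : U))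
    fun x => x.2 ⟨x.1, hSM _ x.1.2⟩
  let b₁ : I → U := Sum.elim (fun x => x.2 ⟨b x.1, hb x.1⟩) fun _ => 1
  let e := Fintype.equivFin I
  refine ⟨a₀, ha₀, Fintype.card I, c₁ ∘ e.symm, b₁ ∘ e.symm, fun j => ?_, fun j => ?_,
    fun j => ?_, fun i => ?_⟩
  · change IsAlgebraic C (c₁ (e.symm j))
    rcases e.symm j with ⟨j, σ⟩ | ⟨s, σ⟩
    · have hn : IsAlgebraic C (Module.finrank F M : U) := isAlgebraic_natCast _
      change IsAlgebraic C (_ / _)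
      rw [div_eq_mul_inv]
      exact (halg σ _ (hc j)).mul hn.inv
    · exact halg σ _ s.2
  · rw [e.symm.surjective.range_comp]
    change b₁ (e.symm j) ∈ _
    rcases e.symm j with ⟨j, σ⟩ | ⟨s, σ⟩
    · exact algHom_mem_adjoin (T := Set.range c₁) σ (fun s hs => IntermediateField.subset_adjoin F _
        ⟨(Sum.inr (⟨s, hs⟩, σ) : I), rfl⟩) ⟨b j, hb j⟩
    · exact one_mem _
  · change b₁ (e.symm j) ≠ 0
    rcases e.symm j with ⟨j, σ⟩ | ⟨s, σ⟩
    · exact (map_ne_zero_iff σ σ.injective).2 fun h0 => hb0 j (congrArg Subtype.val h0)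
    · exact one_ne_zero
  · refine (hf i).trans (congrArg _ ?_)
    refine Eq.trans ?_ (e.symm.sum_comp fun x => c₁ x * (δ i (b₁ x) / b₁ x)).symm
    rw [Fintype.sum_sum_type, Fintype.sum_prod_type]
    simp [c₁, b₁]

end Conjugates

/-! ### Forms integrable in elementary extensions -/

theorem d₀_apply {m : ℕ} {U : Type u} [Field U] [DiffField m U] (g : U) (i : Fin m) :
    d₀ m g i = der i g := by
  simp [d₀, dx, Finset.sum_apply, Pi.single_apply]

section Liouville

variable {m : ℕ} {K : Type v} {U : Type u} [Field K] [Field U] [Algebra K U] [CharZero U]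
  [IsAlgClosed U] [DiffField m U]

/-- Over the field `F(C_U)` generated by `F` and all constants of `U`, the differential of an
element of an elementary extension of `F` is a logarithmic form. -/
theorem exists_form_over_adjoin_constants (F : IntermediateField K U) (hF : IsDiffSubfield m F)
    {E : IntermediateField K U} (hE : IsElementaryExtension m F E) {g : U} (hg : g ∈ E)
    (hη : ∀ i : Fin m, (der i : Derivation ℤ U U) g ∈ F) :
    IsLogForm (der : Fin m → Derivation ℤ U U)
      (IntermediateField.adjoin F {x : U | ∀ i : Fin m, (der i : Derivation ℤ U U) x = 0})
      fun i => der i g := by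
  obtain ⟨-, n, t, rfl, ht⟩ := hE
  let S : Set U := {x : U | ∀ i : Fin m, (der i : Derivation ℤ U U) x = 0}
  let L : IntermediateField K U := (IntermediateField.adjoin F S).restrictScalars K
  have hFL : F ≤ L := fun x hx => IntermediateField.algebraMap_mem _ (⟨x, hx⟩ : F)
  let t' : ℕ → U := fun l => if h : l < n then t ⟨l, h⟩ else 0
  have ht' : ∀ l : Fin n, t' l = t l := fun l => dif_pos l.2
  refine IsLogForm.of_elementary_tower (n := n) der t' L
    (fun i => derivation_mem_adjoin (hF i) fun s hs => ?_)
    (fun x hx => IntermediateField.subset_adjoin F S hx) (fun j hj M hM hl => ?_)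
    (fun i => hFL (hη i)) (F ⊔ IntermediateField.adjoin K (Set.range t)) ?_
    ⟨Empty, inferInstance, Empty.elim, Empty.elim, g, hg, fun j => j.elim, fun j => j.elim,
      fun i => by simp⟩
  · rw [hs i]
    exact zero_mem _
  · have hLM : F ⊔ IntermediateField.adjoin K (t '' {l | l < ⟨j, hj⟩}) ≤ M := by
      refine sup_le (hFL.trans hM) (IntermediateField.adjoin_le_iff.2 ?_)
      rintro _ ⟨l, hlj, rfl⟩
      exact ht' l ▸ hl l hlj
    rw [ht' ⟨j, hj⟩]
    rcases ht ⟨j, hj⟩ _ rfl with h | ⟨b, hb, hb0, h⟩ | ⟨b, hb, h0, h⟩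
    · left
      let _ := (IntermediateField.inclusion hLM).toAlgebra
      have : IsScalarTower ↥(F ⊔ IntermediateField.adjoin K (t '' {l | l < ⟨j, hj⟩})) M U :=
        IsScalarTower.of_algebraMap_eq fun _ => rfl
      exact h.tower_top M
    · exact Or.inr (Or.inl ⟨b, hLM hb, hb0, h⟩)
    · refine Or.inr (Or.inr ⟨b, hLM hb, fun i => ?_⟩)
      rw [← h i, mul_div_cancel₀ _ h0]
  · refine sup_le (hFL.trans le_sup_left) (IntermediateField.adjoin_le_iff.2 ?_)
    rintro _ ⟨l, rfl⟩
    refine (le_sup_right : _ ≤ L ⊔ _) (IntermediateField.subset_adjoin K _ ⟨l, l.2, ht' l⟩)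

/-- The differential of an element of an elementary extension of `F` is a logarithmic form whose
exact part is in `F` and whose coefficients are algebraic over the constants of `F`. -/
theorem exists_form_over_algebraic_constants (F : IntermediateField K U)
    (hF : IsDiffSubfield m F) {E : IntermediateField K U} (hE : IsElementaryExtension m F E)
    {g : U} (hg : g ∈ E) (hη : ∀ i : Fin m, (der i : Derivation ℤ U U) g ∈ F) :
    ∃ a ∈ F, ∃ (n : ℕ) (c b : Fin n → U), (∀ j, IsAlgebraic (constants m F.toSubfield) (c j)) ∧
      (∀ j, b j ∈ IntermediateField.adjoin F (Set.range c)) ∧ (∀ j, b j ≠ 0) ∧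
        ∀ i : Fin m, (der i : Derivation ℤ U U) g = der i a + ∑ j, c j * (der i (b j) / b j) := by
  classical
  obtain ⟨J, _, c, b, a, ha, hc, hb, hf⟩ := exists_form_over_adjoin_constants F hF hE hg hη
  let C := constants m F.toSubfield
  let _ : Algebra C F := RingHom.toAlgebra
    { toFun := fun x => ⟨x, x.2.1⟩
      map_one' := rfl
      map_zero' := rfl
      map_add' := fun _ _ => rfl
      map_mul' := fun _ _ => rfl }
  have hCFU : IsScalarTower C F U := IsScalarTower.of_algebraMap_eq fun _ => rfl
  have hC0 : CharZero C := inferInstance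
  obtain ⟨Sa, hSa, ha'⟩ := IntermediateField.exists_finset_of_mem_adjoin ha
  choose Sb hSb hb' using fun j => IntermediateField.exists_finset_of_mem_adjoin (hb j).1
  let S : Finset U := Sa ∪ Finset.univ.biUnion Sb ∪ Finset.univ.image c
  have hS : ∀ s ∈ S, ∀ i : Fin m, (der i : Derivation ℤ U U) s = 0 := by
    intro s hs
    rcases Finset.mem_union.1 hs with hs | hs
    · rcases Finset.mem_union.1 hs with hs | hs
      · exact hSa hs
      · obtain ⟨j, -, hs⟩ := Finset.mem_biUnion.1 hs
        exact hSb j hs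
    · obtain ⟨j, -, rfl⟩ := Finset.mem_image.1 hs
      exact hc j
  have hFder : ∀ (i : Fin m) (x : F), ∃ y : F,
      (der i : Derivation ℤ U U) (algebraMap F U x) = algebraMap F U y := fun i x =>
    ⟨⟨_, hF i x x.2⟩, rfl⟩
  obtain ⟨S', hS', c', b', a', ha'', hc', hb'', hb0, hf'⟩ :=
    exists_specialization (C := C) hFder (fun i c => c.2.2 i) (fun x hx => ⟨⟨x, x.2, hx⟩, rfl⟩) S hS
      (IntermediateField.adjoin.mono F _ _
        (fun s hs => Finset.mem_union_left _ (Finset.mem_union_left _ hs)) ha')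
      (fun j => Finset.mem_union_right _ (Finset.mem_image_of_mem c (Finset.mem_univ j)))
      (fun j => IntermediateField.adjoin.mono F _ _ (fun s hs => Finset.mem_union_left _
        (Finset.mem_union_right _ (Finset.mem_biUnion.2 ⟨j, Finset.mem_univ j, hs⟩))) (hb' j))
      (fun j => (hb j).2) (fun i => ⟨⟨_, hη i⟩, rfl⟩) hf
  exact exists_form_of_algebraic_constants (C := C) der F hF S' hS' ha'' hc' hb'' hb0 hη hf'

end Liouville

end DiffField

open DiffField in
theorem mainTheorem3 {k : Type v} [Field k] [CharZero k] (m : ℕ)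
    {U : Type u} [Field U] [DiffField m U] [Algebra (DiffField.RatFunField m k) U]
    (hU : DiffField.IsUniversalExtension m (DiffField.RatFunField m k) U)
    (F : IntermediateField (DiffField.RatFunField m k) U) (hF : DiffField.IsDiffSubfield m F)
    (f : Fin m → U) (hf : ∀ i, f i ∈ F)
    (ω : DiffField.OneForm m U) (hω : ω = ∑ i, f i • DiffField.dx m i)
    (hclosed : DiffField.IsClosedForm m ω)
    (E : IntermediateField (DiffField.RatFunField m k) U)
    (hE : DiffField.IsElementaryExtension m F E)
    (g : U) (hg : g ∈ E) (hωg : ω = DiffField.d₀ m g) :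
    ∃ a ∈ F, ∃ (n : ℕ) (c b l : Fin n → U),
      (∀ j, IsAlgebraic (DiffField.constants m F.toSubfield) (c j)) ∧
      (∀ j, b j ∈ IntermediateField.adjoin F (Set.range c)) ∧
      (∀ j, b j ≠ 0) ∧
      (∀ j, DiffField.IsLogOf m (l j) (b j)) ∧
      g = a + ∑ j, c j * l j := by
  have hk : CharZero (RatFunField m k) := charZero_of_injective_algebraMap
    (R := MvPolynomial (Fin m) k) (IsFractionRing.injective _ _)
  have hU0 : CharZero U := charZero_of_injective_algebraMap
    (algebraMap (RatFunField m k) U).injective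
  have hUc : IsAlgClosed U := hU.isAlgClosed
  have hη : ∀ i : Fin m, (der i : Derivation ℤ U U) g ∈ F := by
    intro i
    have h1 : ω i = f i := by
      simp [hω, dx, Finset.sum_apply, Pi.single_apply]
    rw [← d₀_apply, ← hωg, h1]
    exact hf i
  obtain ⟨a, ha, n, c, b, hc, hb, hb0, h⟩ := exists_form_over_algebraic_constants F hF hE hg hη
  choose l hl using fun j => hU.exists_isLogOf (hb0 j)
  have hc0 : ∀ (i : Fin m) j, (der i : Derivation ℤ U U) (c j) = 0 := fun i j =>
    derivation_eq_zero_of_isAlgebraic (C := constants m F.toSubfield) (fun x => x.2.2 i) (hc j)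
  -- The two sides differ by a constant, which is a logarithm of `1`.
  let κ := g - (a + ∑ j, c j * l j)
  have hκ : ∀ i : Fin m, (der i : Derivation ℤ U U) κ = 0 := by
    intro i
    rw [map_sub, map_add, map_sum, h i, sub_eq_zero]
    congr 1
    refine Finset.sum_congr rfl fun j _ => ?_
    rw [Derivation.leibniz, hc0, (hl j).2 i, smul_zero, add_zero, smul_eq_mul]
  refine ⟨a, ha, n + 1, Fin.cons 1 c, Fin.cons 1 b, Fin.cons κ l, fun j => ?_, fun j => ?_,
    fun j => ?_, fun j => ?_, ?_⟩
  · exact Fin.cases isAlgebraic_one hc j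
  · refine Fin.cases (one_mem _) (fun j => ?_) j
    refine IntermediateField.adjoin.mono F _ _ ?_ (hb j)
    rintro _ ⟨i, rfl⟩
    exact ⟨i.succ, rfl⟩
  · exact Fin.cases (one_ne_zero : (1 : U) ≠ 0) hb0 j
  · refine Fin.cases ?_ hl j
    exact ⟨(one_ne_zero : (1 : U) ≠ 0), fun i => by simp [hκ i]⟩
  · rw [Fin.sum_univ_succ]
    simp only [Fin.cons_zero, Fin.cons_succ, κ]
    ring
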